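/- Let $(R,\mathfrak m,k)$ be a commutative Noetherian local ring. For a complex $X=(\cdots\to X_{i+1}\to X_i\to X_{i-1}\to\cdots)$ of $R$-modules put $\sup X=\sup\{i\in\mathbb Z\mid X_i\neq0\}$ and $\inf X=\inf\{i\in\mathbb Z\mid X_i\ne 0\}$. A *quasi-projective resolution* of an $R$-module $M$ is a complex $P$ of projective $R$-modules with $\inf P>-\infty$ for which there exist non-negative integers $a_i$ $(i\in\mathbb Z)$, not all zero, such that $\operatorname{H}_i(P)\cong M^{\oplus a_i}$ for all $i$; it is *finite* if $\sup P<\infty$. The *quasi-projective length* $\operatorname{qpl}_RM\in\mathbb N\cup\{\pm\infty\}$ of $M$ is $$\operatorname{qpl}_RM=\inf\{\sup P-\inf P\mid P\text{ is a finite quasi-projective resolution of }M\}$$ if $M\neq0$ (so $\operatorname{qpl}_RM=\infty$ if there is no such $P$), and $\operatorname{qpl}_RM=-\infty$ if $M=0$. The *finitistic quasi-projective length* of $R$ is $$\operatorname{finqpl}R=\sup\{\operatorname{qpl}_RM\mid M\text{ is a finitely generated }R\text{-module with }\operatorname{qpl}_RM<\infty\}.$$ A local ring is a *hypersurface* if its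 completion with respect to its maximal ideal is isomorphic to $S/(f)$ for some regular local ring $S$ and some regular element (non-zero-divisor) $f$ of $S$. Then the following hold. 1. $\operatorname{finqpl}R=0\iff\operatorname{qpl}_Rk=0\iff R$ is a field. 2. $\operatorname{finqpl}R=1\iff\operatorname{qpl}_Rk=1\iff$ at least one of the following holds: (a) $R$ is a discrete valuation ring; (b) $R$ is artinian and a hypersurface, but not a field; (c) $\mathfrak m^2=0$ and $R$ is not a field. -/

import Mathlib

open CategoryTheory

universe u

namespace QuasiProjective

noncomputable section

section Complexes

variable {R : Type u} [CommRing R]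

/-- The supremum of a complex `X`: the supremum in `[-∞, ∞]` of all `i` with `X_i ≠ 0`
(so `-∞` for the zero complex). -/
def complexSup (X : ChainComplex (ModuleCat.{u} R) ℤ) : EReal :=
  sSup {x : EReal | ∃ i : ℤ, Nontrivial (X.X i) ∧ x = ((i : ℝ) : EReal)}

/-- The infimum of a complex `X`: the infimum in `[-∞, ∞]` of all `i` with `X_i ≠ 0`
(so `∞` for the zero complex). -/
def complexInf (X : ChainComplex (ModuleCat.{u} R) ℤ) : EReal :=
  sInf {x : EReal | ∃ i : ℤ, Nontrivial (X.X i) ∧ x = ((i : ℝ) : EReal)}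

/-- The length `sup X - inf X` of a complex (so `-∞` for the zero complex). -/
def complexLength (X : ChainComplex (ModuleCat.{u} R) ℤ) : EReal :=
  complexSup X - complexInf X

/-- `P` is a quasi-projective resolution of the `R`-module `M`: a bounded below complex of
projective modules for which there are nonnegative integers `a_i`, not all zero, with
`H_i(P) ≅ M^{a_i}`. The modules `P_i` need not be finitely generated.
(For `M ≠ 0` one has `a_i = 0` outside the support of `P`, and the zero complex is excluded;
the zero complex is a quasi-projective resolution of `M = 0`.) -/
structure IsQuasiProjectiveResolution (M : Type u) [AddCommGroup M] [Module R M]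
    (P : ChainComplex (ModuleCat.{u} R) ℤ) : Prop where
  boundedBelow : ⊥ < complexInf P
  projective : ∀ i : ℤ, Module.Projective R (P.X i)
  homology : ∃ a : ℤ → ℕ, (∃ i, a i ≠ 0) ∧
    ∀ i : ℤ, Nonempty ((P.homology i : ModuleCat.{u} R) ≃ₗ[R] (Fin (a i) → M))

/-- A quasi-projective resolution `P` is finite if `sup P < ∞`. -/
structure IsFiniteQuasiProjectiveResolution (M : Type u) [AddCommGroup M] [Module R M]
    (P : ChainComplex (ModuleCat.{u} R) ℤ) : Prop extends
    IsQuasiProjectiveResolution M P where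
  boundedAbove : complexSup P < ⊤

end Complexes

open Classical in
/-- The quasi-projective length of an `R`-module `M`: the infimum of the lengths of the finite
quasi-projective resolutions of `M` (`∞` if there are none) if `M ≠ 0`, and `-∞` if `M = 0`. -/
def qpl (R : Type u) [CommRing R] (M : Type u) [AddCommGroup M] [Module R M] : EReal :=
  if Nontrivial M then
    sInf {x : EReal | ∃ P : ChainComplex (ModuleCat.{u} R) ℤ,
      IsFiniteQuasiProjectiveResolution M P ∧ x = complexLength P}
  else ⊥

/-- The finitistic quasi-projective length of `R`: the supremum of the `qpl R M`, where `M` runs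
over the finitely generated `R`-modules with `qpl R M < ∞`. -/
def finqpl (R : Type u) [CommRing R] : EReal :=
  sSup {x : EReal | ∃ M : ModuleCat.{u} R, Module.Finite R M ∧ qpl R M < ⊤ ∧ x = qpl R M}

/-- A local ring is a hypersurface if its completion with respect to the maximal ideal is the
quotient of a regular local ring by a regular element. -/
def IsHypersurface (R : Type u) [CommRing R] [IsLocalRing R] : Prop :=
  ∃ (S : Type u) (_ : CommRing S) (_ : IsRegularLocalRing S) (f : S),
    f ∈ nonZeroDivisors S ∧
    Nonempty (AdicCompletion (IsLocalRing.maximalIdeal R) R ≃+* S ⧸ Ideal.span {f})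

end

end QuasiProjective

/-! The Koszul complex on generators of 𝔪 has homology killed by 𝔪, so qpl k is finite and is a
lower bound for finqpl R. Lengths are integers, so what matters is the meaning of lengths 0 and 1.
Length 0 makes a nonzero power of k projective, which forces R to be a field; over a field every
module is projective.

Length at most 1 gives a map F → G of projectives with kernel k^a and cokernel k^b. If b = 0 it
splits and k is projective. Otherwise, comparison with a minimal presentation R^n → R → k shows that
𝔪 kills the syzygies of 𝔪 (`smul_syzygy_eq_zero`). For n ≥ 2 the Koszul relations are among these
and give 𝔪² = 0. For n ≤ 1 the ideal 𝔪 is principal, so R is artinian or a discrete valuation ring,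
and in the artinian case a form of Cohen's structure theorem makes R a hypersurface
(`isHypersurface_of_isPrincipal`).

Conversely, over a discrete valuation ring finitely generated modules have free resolutions of
length 1. If R = S/(f) with S a discrete valuation ring, write M = S^c/K with K free; multiplication
by f yields an exact sequence 0 → M → K/fK → S^c/fS^c → M → 0 with free middle terms
(`qpl_le_one_of_quotient`). If 𝔪² = 0 ≠ 𝔪, injections between projectives split, so a module with a
finite quasi-projective resolution embeds in a projective module. If finitely generated, it is then
R^c ⊕ k^y (`exists_equiv_free_prod`), which has an explicit two-term resolution.

The structure theorem needs a lift of the residue field to R. In characteristic zero k is formally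
smooth over ℚ. In characteristic p, Zorn's lemma inside a valuation ring produces a discrete
valuation ring with uniformizer p and residue field k, and it maps to R by lifting along square-zero
extensions (`exists_lift_of_isNilpotent`). -/

namespace QuasiProjective

/-! ### Homology of complexes of modules -/

section Homology

variable {R : Type u} [CommRing R]

/-- The homology of a complex of modules, as cycles modulo boundaries. -/
theorem nonempty_homology_equiv (K : ChainComplex (ModuleCat.{u} R) ℤ) (i j k : ℤ)
    (hi : j + 1 = i) (hk : k + 1 = j) :
    Nonempty ((K.homology j : ModuleCat.{u} R) ≃ₗ[R]
      (LinearMap.ker (K.d j k).hom ⧸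
        (LinearMap.range (K.d i j).hom).comap (LinearMap.ker (K.d j k).hom).subtype)) := by
  have e1 := K.homologyIsoSc' i j k (by subst hi; simp) (by subst hk; simp)
  have e2 := (K.sc' i j k).moduleCatHomologyIso
  refine ⟨(e1 ≪≫ e2).toLinearEquiv.trans (Submodule.quotEquivOfEq _ _ ?_)⟩
  ext ⟨x, hx⟩
  simp only [LinearMap.mem_range]
  constructor
  · rintro ⟨y, hy⟩
    exact ⟨y, congrArg Subtype.val hy⟩
  · rintro ⟨y, hy⟩
    exact ⟨y, Subtype.ext hy⟩

theorem nonempty_homology_equiv_of_surjective (K : ChainComplex (ModuleCat.{u} R) ℤ) (i j k : ℤ)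
    (hi : j + 1 = i) (hk : k + 1 = j) {N : Type*} [AddCommGroup N] [Module R N]
    (g : LinearMap.ker (K.d j k).hom →ₗ[R] N) (hg : Function.Surjective g)
    (hker : ∀ z, g z = 0 ↔ (z : K.X j) ∈ LinearMap.range (K.d i j).hom) :
    Nonempty ((K.homology j : ModuleCat.{u} R) ≃ₗ[R] N) := by
  obtain ⟨e⟩ := nonempty_homology_equiv K i j k hi hk
  refine ⟨e.trans ((Submodule.quotEquivOfEq _ _ ?_).trans (g.quotKerEquivOfSurjective hg))⟩
  ext z
  simpa using (hker z).symm

theorem subsingleton_homology (K : ChainComplex (ModuleCat.{u} R) ℤ) (j : ℤ)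
    [Subsingleton (K.X j)] : Subsingleton (K.homology j : ModuleCat.{u} R) := by
  obtain ⟨e⟩ := nonempty_homology_equiv K (j + 1) j (j - 1) rfl (by ring)
  exact e.toEquiv.subsingleton

/-- The complex with terms `A i` of a module `E` with a differential that lowers the degree of
the family `A` of submodules by one. -/
noncomputable def gradedComplex {E : Type u} [AddCommGroup E] [Module R E] (A : ℤ → Submodule R E)
    (d : E →ₗ[R] E) (hd : ∀ i j, j + 1 = i → ∀ x ∈ A i, d x ∈ A j) (hdd : ∀ x, d (d x) = 0) :
    ChainComplex (ModuleCat.{u} R) ℤ where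
  X i := ModuleCat.of R (A i)
  d i j := if h : j + 1 = i then ModuleCat.ofHom (d.restrict (hd i j h)) else 0
  shape i j h := by
    have h' : ¬ j + 1 = i := h
    simp [h']
  d_comp_d' i j k hij hjk := by
    have h1 : j + 1 = i := hij
    have h2 : k + 1 = j := hjk
    rw [dif_pos h1, dif_pos h2]
    ext x
    exact congrArg Subtype.val (Subtype.ext (hdd (x : A i)) : (⟨d (d (x : A i)), _⟩ : A k) = 0)

theorem gradedComplex_d {E : Type u} [AddCommGroup E] [Module R E] {A : ℤ → Submodule R E}
    {d : E →ₗ[R] E} (hd : ∀ i j, j + 1 = i → ∀ x ∈ A i, d x ∈ A j) (hdd : ∀ x, d (d x) = 0)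
    {i j : ℤ} (h : j + 1 = i) :
    ((gradedComplex A d hd hdd).d i j).hom = d.restrict (hd i j h) := by
  simp only [gradedComplex, h, dif_pos]
  rfl

/-- Cycles and boundaries are formed in the ambient module E, so homology can be read off from any
surjection on cycles whose kernel is the boundaries, without touching subtypes or the categorical
construction. -/
theorem gradedComplex_homology {E : Type u} [AddCommGroup E] [Module R E] {A : ℤ → Submodule R E}
    {d : E →ₗ[R] E} (hd : ∀ i j, j + 1 = i → ∀ x ∈ A i, d x ∈ A j) (hdd : ∀ x, d (d x) = 0)
    (j : ℤ) {N : Type*} [AddCommGroup N] [Module R N]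
    (g : ↥(A j ⊓ LinearMap.ker d) →ₗ[R] N) (hg : Function.Surjective g)
    (hker : ∀ z, g z = 0 ↔ ∃ y ∈ A (j + 1), d y = z) :
    Nonempty (((gradedComplex A d hd hdd).homology j : ModuleCat.{u} R) ≃ₗ[R] N) := by
  have hk : j - 1 + 1 = j := by ring
  have hz : ∀ z : A j, z ∈ LinearMap.ker (d.restrict (hd j (j - 1) hk)) → d z = 0 :=
    fun z hz ↦ congrArg Subtype.val hz
  let g' : LinearMap.ker (d.restrict (hd j (j - 1) hk)) →ₗ[R] N :=
    g ∘ₗ LinearMap.codRestrict _ ((A j).subtype ∘ₗ Submodule.subtype _)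
      fun z ↦ ⟨z.1.2, hz z.1 z.2⟩
  obtain ⟨e⟩ := nonempty_homology_equiv (gradedComplex A d hd hdd) (j + 1) j (j - 1) rfl hk
  rw [gradedComplex_d hd hdd hk, gradedComplex_d hd hdd rfl] at e
  have hg' : Function.Surjective g' := fun n ↦ by
    obtain ⟨z, rfl⟩ := hg n
    exact ⟨⟨⟨z, z.2.1⟩, Subtype.ext z.2.2⟩, rfl⟩
  refine ⟨e.trans ((Submodule.quotEquivOfEq _ _ ?_).trans (g'.quotKerEquivOfSurjective hg'))⟩
  ext z
  refine Iff.trans ?_ (hker ⟨z.1.1, z.1.2, hz z.1 z.2⟩).symm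
  constructor
  · rintro ⟨y, hy⟩
    exact ⟨(y : A (j + 1)).1, (y : A (j + 1)).2, congrArg Subtype.val hy⟩
  · rintro ⟨y, hy, hyz⟩
    exact ⟨(⟨y, hy⟩ : A (j + 1)), Subtype.ext hyz⟩

end Homology

/-! ### Lengths of complexes and quasi-projective length -/

section Length

variable {R : Type u} [CommRing R]

theorem intCast_strictMono : StrictMono fun i : ℤ ↦ ((i : ℝ) : EReal) :=
  EReal.coe_strictMono.comp Int.cast_strictMono

theorem complexSup_le {X : ChainComplex (ModuleCat.{u} R) ℤ} {s : ℤ}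
    (h : ∀ i, Nontrivial (X.X i) → i ≤ s) : complexSup X ≤ ((s : ℝ) : EReal) :=
  sSup_le fun _ ⟨i, hi, hx⟩ ↦ hx ▸ intCast_strictMono.monotone (h i hi)

theorem le_complexInf {X : ChainComplex (ModuleCat.{u} R) ℤ} {t : ℤ}
    (h : ∀ i, Nontrivial (X.X i) → t ≤ i) : ((t : ℝ) : EReal) ≤ complexInf X :=
  le_sInf fun _ ⟨i, hi, hx⟩ ↦ hx ▸ intCast_strictMono.monotone (h i hi)

theorem le_complexSup {X : ChainComplex (ModuleCat.{u} R) ℤ} {i : ℤ} (h : Nontrivial (X.X i)) :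
    ((i : ℝ) : EReal) ≤ complexSup X :=
  le_sSup ⟨i, h, rfl⟩

theorem complexInf_le {X : ChainComplex (ModuleCat.{u} R) ℤ} {i : ℤ} (h : Nontrivial (X.X i)) :
    complexInf X ≤ ((i : ℝ) : EReal) :=
  sInf_le ⟨i, h, rfl⟩

theorem exists_int_ge_of_lt_top {x : EReal} (h : x < ⊤) : ∃ n : ℤ, x ≤ ((n : ℝ) : EReal) := by
  obtain ⟨r, hr, _⟩ := EReal.lt_iff_exists_real_btwn.1 h
  exact ⟨⌈r⌉, hr.le.trans (EReal.coe_le_coe_iff.2 (Int.le_ceil r))⟩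

theorem exists_int_le_of_bot_lt {x : EReal} (h : ⊥ < x) : ∃ n : ℤ, ((n : ℝ) : EReal) ≤ x := by
  obtain ⟨r, _, hr⟩ := EReal.lt_iff_exists_real_btwn.1 h
  exact ⟨⌊r⌋, (EReal.coe_le_coe_iff.2 (Int.floor_le r)).trans hr.le⟩

/-- A nonzero bounded complex has a top and a bottom degree, and their difference is its length. -/
theorem exists_top_bottom {X : ChainComplex (ModuleCat.{u} R) ℤ} (hinf : ⊥ < complexInf X)
    (hsup : complexSup X < ⊤) (hX : ∃ i, Nontrivial (X.X i)) :
    ∃ t s : ℤ, Nontrivial (X.X t) ∧ Nontrivial (X.X s) ∧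
      (∀ i, Nontrivial (X.X i) → t ≤ i ∧ i ≤ s) ∧
      complexLength X = (((s - t : ℤ) : ℝ) : EReal) := by
  obtain ⟨n, hn⟩ := exists_int_ge_of_lt_top hsup
  obtain ⟨m, hm⟩ := exists_int_le_of_bot_lt hinf
  obtain ⟨s, hs, hs'⟩ := Int.exists_greatest_of_bdd (P := fun i ↦ Nontrivial (X.X i))
    ⟨n, fun i hi ↦ intCast_strictMono.le_iff_le.1 ((le_complexSup hi).trans hn)⟩ hX
  obtain ⟨t, ht, ht'⟩ := Int.exists_least_of_bdd (P := fun i ↦ Nontrivial (X.X i))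
    ⟨m, fun i hi ↦ intCast_strictMono.le_iff_le.1 (hm.trans (complexInf_le hi))⟩ hX
  refine ⟨t, s, ht, hs, fun i hi ↦ ⟨ht' i hi, hs' i hi⟩, ?_⟩
  rw [complexLength, (complexSup_le hs').antisymm (le_complexSup hs),
    (complexInf_le ht).antisymm (le_complexInf ht')]
  push_cast
  rfl

variable {M : Type u} [AddCommGroup M] [Module R M]

theorem IsQuasiProjectiveResolution.exists_nontrivial [Nontrivial M]
    {P : ChainComplex (ModuleCat.{u} R) ℤ} (hP : IsQuasiProjectiveResolution M P) :
    ∃ i, Nontrivial (P.X i) := by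
  obtain ⟨a, ⟨i, hi⟩, ha⟩ := hP.homology
  refine ⟨i, not_subsingleton_iff_nontrivial.1 fun h ↦ ?_⟩
  obtain ⟨e⟩ := ha i
  have := subsingleton_homology P i
  have : NeZero (a i) := ⟨hi⟩
  exact not_subsingleton (Fin (a i) → M) e.symm.toEquiv.subsingleton

theorem IsFiniteQuasiProjectiveResolution.exists_top_bottom [Nontrivial M]
    {P : ChainComplex (ModuleCat.{u} R) ℤ} (hP : IsFiniteQuasiProjectiveResolution M P) :
    ∃ t s : ℤ, t ≤ s ∧ (∀ i, Nontrivial (P.X i) → t ≤ i ∧ i ≤ s) ∧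
      complexLength P = (((s - t : ℤ) : ℝ) : EReal) := by
  obtain ⟨t, s, ht, _, h, hl⟩ := QuasiProjective.exists_top_bottom hP.boundedBelow hP.boundedAbove
    hP.exists_nontrivial
  exact ⟨t, s, (h t ht).2, h, hl⟩

theorem complexLength_le {P : ChainComplex (ModuleCat.{u} R) ℤ} {t s : ℤ}
    (h : ∀ i, Nontrivial (P.X i) → t ≤ i ∧ i ≤ s) :
    complexLength P ≤ (((s - t : ℤ) : ℝ) : EReal) := by
  have h1 := complexSup_le (s := s) fun i hi ↦ (h i hi).2
  have h2 := le_complexInf (t := t) fun i hi ↦ (h i hi).1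
  refine (EReal.sub_le_sub h1 h2).trans ?_
  push_cast
  exact le_rfl

theorem IsFiniteQuasiProjectiveResolution.of_bounds {P : ChainComplex (ModuleCat.{u} R) ℤ}
    {t s : ℤ} (h : ∀ i, Nontrivial (P.X i) → t ≤ i ∧ i ≤ s)
    (hproj : ∀ i, Module.Projective R (P.X i))
    (hom : ∃ a : ℤ → ℕ, (∃ i, a i ≠ 0) ∧
      ∀ i : ℤ, Nonempty ((P.homology i : ModuleCat.{u} R) ≃ₗ[R] (Fin (a i) → M))) :
    IsFiniteQuasiProjectiveResolution M P where
  boundedBelow := (EReal.bot_lt_coe t).trans_le (le_complexInf fun i hi ↦ (h i hi).1)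
  boundedAbove := (complexSup_le (s := s) fun i hi ↦ (h i hi).2).trans_lt (EReal.coe_lt_top _)
  projective := hproj
  homology := hom

theorem qpl_of_subsingleton [Subsingleton M] : qpl R M = ⊥ := by
  rw [qpl, if_neg (not_nontrivial_iff_subsingleton.2 ‹_›)]

theorem qpl_le_of_bounds {P : ChainComplex (ModuleCat.{u} R) ℤ} {t s : ℤ}
    (h : ∀ i, Nontrivial (P.X i) → t ≤ i ∧ i ≤ s)
    (hP : IsFiniteQuasiProjectiveResolution M P) :
    qpl R M ≤ (((s - t : ℤ) : ℝ) : EReal) := by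
  by_cases hM : Nontrivial M
  · rw [qpl, if_pos hM]
    exact sInf_le_of_le ⟨P, hP, rfl⟩ (complexLength_le h)
  · rw [qpl, if_neg hM]
    exact bot_le

theorem qpl_nonneg [Nontrivial M] : 0 ≤ qpl R M := by
  rw [qpl, if_pos ‹_›]
  refine le_sInf ?_
  rintro _ ⟨P, hP, rfl⟩
  obtain ⟨t, s, hts, -, hl⟩ := hP.exists_top_bottom
  rw [hl]
  exact_mod_cast sub_nonneg.2 hts

/-- A finite quasi-projective length is attained. -/
theorem exists_resolution_of_qpl_le [Nontrivial M] {n : ℤ} (h : qpl R M ≤ ((n : ℝ) : EReal)) :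
    ∃ P : ChainComplex (ModuleCat.{u} R) ℤ, IsFiniteQuasiProjectiveResolution M P ∧
      ∃ t s : ℤ, s - t ≤ n ∧ ∀ i, Nontrivial (P.X i) → t ≤ i ∧ i ≤ s := by
  -- Lengths are integers: an infimum of at most n forces some length below n + 1, hence at most n.
  have h1 : qpl R M < (((n + 1 : ℤ) : ℝ) : EReal) :=
    h.trans_lt (intCast_strictMono (Int.lt_succ n))
  rw [qpl, if_pos ‹_›, sInf_lt_iff] at h1
  obtain ⟨_, ⟨P, hP, rfl⟩, hl⟩ := h1
  obtain ⟨t, s, -, hb, hl'⟩ := hP.exists_top_bottom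
  rw [hl'] at hl
  exact ⟨P, hP, t, s, Int.lt_add_one_iff.1 (intCast_strictMono.lt_iff_lt.1 hl), hb⟩

theorem exists_resolution_of_qpl_lt_top [Nontrivial M] (h : qpl R M < ⊤) :
    ∃ P : ChainComplex (ModuleCat.{u} R) ℤ, IsFiniteQuasiProjectiveResolution M P := by
  obtain ⟨n, hn⟩ := exists_int_ge_of_lt_top h
  obtain ⟨P, hP, -⟩ := exists_resolution_of_qpl_le hn
  exact ⟨P, hP⟩

theorem one_le_qpl [Nontrivial M] (h : qpl R M ≠ 0) : 1 ≤ qpl R M := by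
  by_contra! h1
  refine h (le_antisymm ?_ qpl_nonneg)
  rw [qpl, if_pos ‹_›, sInf_lt_iff] at h1
  obtain ⟨_, ⟨P, hP, rfl⟩, hl⟩ := h1
  obtain ⟨t, s, -, hb, hl'⟩ := hP.exists_top_bottom
  refine (qpl_le_of_bounds hb hP).trans ?_
  rw [hl'] at hl
  have : s - t < 1 := by exact_mod_cast hl
  exact_mod_cast Int.lt_add_one_iff.1 this

end Length

/-! ### Two-term resolutions -/

section TwoTerm

variable {R : Type u} [CommRing R] {M : Type u} [AddCommGroup M] [Module R M]
variable {F G : Type u} [AddCommGroup F] [Module R F] [AddCommGroup G] [Module R G]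

/-- The grading of `F × G` with `F` in degree one and `G` in degree zero. -/
def twoTermGrading (R F G : Type u) [CommRing R] [AddCommGroup F] [Module R F] [AddCommGroup G]
    [Module R G] (i : ℤ) : Submodule R (F × G) :=
  if i = 1 then Submodule.prod ⊤ ⊥ else if i = 0 then Submodule.prod ⊥ ⊤ else ⊥

theorem twoTermGrading_one : twoTermGrading R F G 1 = Submodule.prod ⊤ ⊥ := by
  simp [twoTermGrading]

theorem twoTermGrading_zero : twoTermGrading R F G 0 = Submodule.prod ⊥ ⊤ := by
  simp [twoTermGrading]

theorem twoTermGrading_of_ne {i : ℤ} (h0 : i ≠ 0) (h1 : i ≠ 1) : twoTermGrading R F G i = ⊥ := by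
  simp [twoTermGrading, h0, h1]

/-- A map of projective modules with kernel and cokernel sums of copies of `M` bounds the
quasi-projective length of `M` by one. -/
theorem qpl_le_one_of_map [Module.Projective R F] [Module.Projective R G] (f : F →ₗ[R] G)
    {a b : ℕ} (hab : a ≠ 0 ∨ b ≠ 0) (ea : LinearMap.ker f ≃ₗ[R] (Fin a → M))
    (eb : (G ⧸ LinearMap.range f) ≃ₗ[R] (Fin b → M)) : qpl R M ≤ 1 := by
  let d : F × G →ₗ[R] F × G := LinearMap.inr R F G ∘ₗ f ∘ₗ LinearMap.fst R F G
  have hd : ∀ i j, j + 1 = i → ∀ x ∈ twoTermGrading R F G i, d x ∈ twoTermGrading R F G j := by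
    rintro i j rfl x hx
    by_cases h1 : j = 0
    · subst h1
      rw [twoTermGrading_zero]
      exact ⟨rfl, trivial⟩
    · suffices x.1 = 0 by
        simp only [d, LinearMap.comp_apply, LinearMap.fst_apply, this, map_zero, zero_mem]
      by_cases h2 : j + 1 = 0
      · rw [h2, twoTermGrading_zero] at hx
        exact hx.1
      · rw [twoTermGrading_of_ne h2 (by omega)] at hx
        rw [(Submodule.mem_bot R).1 hx, Prod.fst_zero]
  have hdd : ∀ x, d (d x) = 0 := fun x ↦ by simp [d]
  let P := gradedComplex (twoTermGrading R F G) d hd hdd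
  have hsub : ∀ i : ℤ, i ≠ 0 → i ≠ 1 → Subsingleton (P.X i) := by
    intro i h0 h1
    change Subsingleton (twoTermGrading R F G i)
    rw [twoTermGrading_of_ne h0 h1]
    infer_instance
  have hb : ∀ i, Nontrivial (P.X i) → (0 : ℤ) ≤ i ∧ i ≤ 1 := by
    intro i hi
    by_contra h
    exact not_subsingleton _ (hsub i (by omega) (by omega))
  have hproj : ∀ i, Module.Projective R (P.X i) := by
    intro i
    change Module.Projective R (twoTermGrading R F G i)
    by_cases h0 : i = 0
    · rw [h0, twoTermGrading_zero]
      exact .of_equiv ((LinearEquiv.ofInjective (LinearMap.inr R F G)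
        LinearMap.inr_injective).trans (LinearEquiv.ofEq _ _ (by ext ⟨x, y⟩; simp [eq_comm])))
    · by_cases h1 : i = 1
      · rw [h1, twoTermGrading_one]
        exact .of_equiv ((LinearEquiv.ofInjective (LinearMap.inl R F G)
          LinearMap.inl_injective).trans (LinearEquiv.ofEq _ _ (by ext ⟨x, y⟩; simp [eq_comm])))
      · rw [twoTermGrading_of_ne h0 h1]
        infer_instance
  have H1 : Nonempty ((P.homology 1 : ModuleCat.{u} R) ≃ₗ[R] (Fin a → M)) := by
    obtain ⟨e⟩ := gradedComplex_homology hd hdd 1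
      (LinearMap.codRestrict (LinearMap.ker f) (LinearMap.fst R F G ∘ₗ Submodule.subtype _)
        (fun z ↦ congrArg Prod.snd z.2.2))
      (fun z ↦ ⟨⟨(z, 0), by rw [twoTermGrading_one]; exact ⟨trivial, rfl⟩,
        by simp [d]⟩, rfl⟩) (fun z ↦ by
        obtain ⟨⟨z1, z2⟩, hz, hz'⟩ := z
        have hz2 : z2 = 0 := by
          rw [twoTermGrading_one] at hz
          exact hz.2
        subst hz2
        constructor
        · intro h
          have : z1 = 0 := congrArg Subtype.val h
          subst this
          exact ⟨0, zero_mem _, map_zero d⟩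
        · rintro ⟨y, hy, hyz⟩
          exact Subtype.ext (congrArg Prod.fst hyz).symm)
    exact ⟨e.trans ea⟩
  have H0 : Nonempty ((P.homology 0 : ModuleCat.{u} R) ≃ₗ[R] (Fin b → M)) := by
    obtain ⟨e⟩ := gradedComplex_homology hd hdd 0
      ((LinearMap.range f).mkQ ∘ₗ LinearMap.snd R F G ∘ₗ Submodule.subtype _)
      (fun q ↦ by
        obtain ⟨z, rfl⟩ := Submodule.mkQ_surjective _ q
        exact ⟨⟨(0, z), by rw [twoTermGrading_zero]; exact ⟨rfl, trivial⟩, by simp [d]⟩, rfl⟩)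
      (fun z ↦ by
        obtain ⟨⟨z1, z2⟩, hz, hz'⟩ := z
        have hz1 : z1 = 0 := by
          rw [twoTermGrading_zero] at hz
          exact hz.1
        subst hz1
        refine (Submodule.Quotient.mk_eq_zero _).trans ?_
        constructor
        · rintro ⟨y, hy⟩
          refine ⟨(y, 0), ?_, by simpa [d] using hy⟩
          rw [zero_add, twoTermGrading_one]
          exact ⟨trivial, rfl⟩
        · rintro ⟨y, hy, hyz⟩
          exact ⟨y.1, congrArg Prod.snd hyz⟩)
    exact ⟨e.trans eb⟩
  have hres : IsFiniteQuasiProjectiveResolution M P := by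
    refine .of_bounds hb hproj ⟨fun i ↦ if i = 0 then b else if i = 1 then a else 0, ?_, ?_⟩
    · rcases hab with h | h
      · exact ⟨1, by simpa using h⟩
      · exact ⟨0, by simpa using h⟩
    · intro i
      by_cases h0 : i = 0
      · subst h0
        simpa using! H0
      · by_cases h1 : i = 1
        · subst h1
          simpa using! H1
        · have := hsub i h0 h1
          have := subsingleton_homology P i
          beta_reduce
          rw [if_neg h0, if_neg h1]
          exact ⟨LinearEquiv.ofSubsingleton _ _⟩
  simpa using qpl_le_of_bounds hb hres

/-- A quasi-projective length of at most one is witnessed by a map of projective modules. -/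
theorem exists_map_of_qpl_le_one [Nontrivial M] (h : qpl R M ≤ 1) :
    ∃ (F G : Type u) (_ : AddCommGroup F) (_ : Module R F) (_ : AddCommGroup G) (_ : Module R G)
      (f : F →ₗ[R] G) (a b : ℕ), Module.Projective R F ∧ Module.Projective R G ∧
      (a ≠ 0 ∨ b ≠ 0) ∧ Nonempty (LinearMap.ker f ≃ₗ[R] (Fin a → M)) ∧
      Nonempty ((G ⧸ LinearMap.range f) ≃ₗ[R] (Fin b → M)) := by
  obtain ⟨P, hP, t, s, hts, hb⟩ := exists_resolution_of_qpl_le (n := 1) (by simpa using h)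
  have hsub : ∀ i, i ≠ t → i ≠ t + 1 → Subsingleton (P.X i) := by
    intro i h0 h1
    rw [← not_nontrivial_iff_subsingleton]
    intro hi
    have := hb i hi
    omega
  obtain ⟨a, ⟨i, hi⟩, ha⟩ := hP.homology
  have hit : i = t ∨ i = t + 1 := by
    by_contra hcon
    push Not at hcon
    have := hsub i hcon.1 hcon.2
    have := subsingleton_homology P i
    obtain ⟨e⟩ := ha i
    have : NeZero (a i) := ⟨hi⟩
    exact not_subsingleton (Fin (a i) → M) e.symm.toEquiv.subsingleton
  have hs1 := hsub (t + 1 + 1) (by omega) (by omega)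
  have hs2 := hsub (t - 1) (by omega) (by omega)
  obtain ⟨e1⟩ := ha (t + 1)
  obtain ⟨e0⟩ := ha t
  refine ⟨P.X (t + 1), P.X t, inferInstance, inferInstance, inferInstance, inferInstance,
    (P.d (t + 1) t).hom, a (t + 1), a t, hP.projective _, hP.projective _, ?_, ?_, ?_⟩
  · rcases hit with rfl | rfl
    · exact Or.inr hi
    · exact Or.inl hi
  · obtain ⟨e⟩ := nonempty_homology_equiv_of_surjective P (t + 1 + 1) (t + 1) t rfl rfl
      LinearMap.id Function.surjective_id (fun z ↦ by
        constructor
        · intro hz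
          exact ⟨0, by simpa using (congrArg Subtype.val hz).symm⟩
        · rintro ⟨y, hy⟩
          rw [Subsingleton.elim y 0, map_zero] at hy
          exact Subtype.ext hy.symm)
    exact ⟨e.symm.trans e1⟩
  · obtain ⟨e⟩ := nonempty_homology_equiv_of_surjective P (t + 1) t (t - 1) rfl (by ring)
      ((LinearMap.range (P.d (t + 1) t).hom).mkQ ∘ₗ Submodule.subtype _)
      (fun q ↦ by
        obtain ⟨z, rfl⟩ := Submodule.mkQ_surjective _ q
        exact ⟨⟨z, Subsingleton.elim _ _⟩, rfl⟩)
      (fun z ↦ Submodule.Quotient.mk_eq_zero _)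
    exact ⟨e.symm.trans e0⟩

end TwoTerm

/-! ### The Koszul complex: finiteness of qpl k -/

section Koszul

open IsLocalRing

theorem nonempty_equiv_residueField_pow {R : Type*} [CommRing R] [IsLocalRing R] {N : Type*}
    [AddCommGroup N] [Module R N] [Module.Finite R N]
    (h : ∀ r ∈ maximalIdeal R, ∀ x : N, r • x = 0) :
    ∃ a : ℕ, Nonempty (N ≃ₗ[R] (Fin a → ResidueField R)) := by
  have ht : Module.IsTorsionBySet R N (maximalIdeal R : Set R) := fun x r ↦ h r r.2 x
  let _ : Module (ResidueField R) N := ht.module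
  have : IsScalarTower R (ResidueField R) N := ht.isScalarTower
  have : Module.Finite (ResidueField R) N := .of_restrictScalars_finite R _ _
  exact ⟨_, ⟨(Module.finBasis (ResidueField R) N).equivFun.restrictScalars R⟩⟩

variable {R : Type u} [CommRing R]

/-- The exterior powers of `R ^ n`, as a family of submodules indexed by the integers. -/
noncomputable def exteriorGrading (R : Type u) [CommRing R] (n : ℕ) (i : ℤ) :
    Submodule R (ExteriorAlgebra R (Fin n → R)) :=
  if 0 ≤ i then ⋀[R]^i.toNat (Fin n → R) else ⊥

theorem exteriorGrading_natCast (n i : ℕ) :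
    exteriorGrading R n i = ⋀[R]^i (Fin n → R) := by
  simp [exteriorGrading]

theorem exteriorGrading_of_neg {n : ℕ} {i : ℤ} (h : i < 0) : exteriorGrading R n i = ⊥ := by
  simp [exteriorGrading, h]

theorem exteriorGrading_of_lt [Nontrivial R] {n : ℕ} {i : ℤ} (h : (n : ℤ) < i) :
    Subsingleton (exteriorGrading R n i) := by
  obtain ⟨i, rfl⟩ := Int.eq_ofNat_of_zero_le (by omega : 0 ≤ i)
  rw [exteriorGrading_natCast]
  have : Module.finrank R (⋀[R]^i (Fin n → R)) = 0 := by
    rw [exteriorPower.finrank_eq, Module.finrank_fin_fun]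
    exact Nat.choose_eq_zero_of_lt (by omega)
  exact (Module.finrank_eq_zero_iff_of_free R _).1 this

theorem projective_exteriorGrading (n : ℕ) (i : ℤ) :
    Module.Projective R (exteriorGrading R n i) := by
  rcases lt_or_ge i 0 with h | h
  · rw [exteriorGrading_of_neg h]
    infer_instance
  · obtain ⟨i, rfl⟩ := Int.eq_ofNat_of_zero_le h
    rw [exteriorGrading_natCast]
    infer_instance

theorem finite_exteriorGrading (n : ℕ) (i : ℤ) : Module.Finite R (exteriorGrading R n i) := by
  rcases lt_or_ge i 0 with h | h
  · rw [exteriorGrading_of_neg h]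
    infer_instance
  · obtain ⟨i, rfl⟩ := Int.eq_ofNat_of_zero_le h
    rw [exteriorGrading_natCast]
    infer_instance

/-- The Koszul differential on the exterior algebra. -/
noncomputable def koszulDifferential {n : ℕ} (φ : Module.Dual R (Fin n → R)) :
    ExteriorAlgebra R (Fin n → R) →ₗ[R] ExteriorAlgebra R (Fin n → R) :=
  CliffordAlgebra.contractLeft (Q := 0) φ

variable {n : ℕ} (φ : Module.Dual R (Fin n → R))

theorem koszulDifferential_koszulDifferential (x : ExteriorAlgebra R (Fin n → R)) :
    koszulDifferential φ (koszulDifferential φ x) = 0 :=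
  CliffordAlgebra.contractLeft_contractLeft φ x

theorem koszulDifferential_ι_mul (v : Fin n → R) (x : ExteriorAlgebra R (Fin n → R)) :
    koszulDifferential φ (ExteriorAlgebra.ι R v * x) =
      φ v • x - ExteriorAlgebra.ι R v * koszulDifferential φ x :=
  CliffordAlgebra.contractLeft_ι_mul φ v x

theorem koszulDifferential_of_mem_zero {x : ExteriorAlgebra R (Fin n → R)}
    (hx : x ∈ ⋀[R]^0 (Fin n → R)) : koszulDifferential φ x = 0 := by
  rw [ExteriorAlgebra.exteriorPower, pow_zero, Submodule.mem_one] at hx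
  obtain ⟨r, rfl⟩ := hx
  exact CliffordAlgebra.contractLeft_algebraMap 0 φ r

theorem ι_mul_mem {i : ℕ} (v : Fin n → R) {x : ExteriorAlgebra R (Fin n → R)}
    (hx : x ∈ ⋀[R]^i (Fin n → R)) : ExteriorAlgebra.ι R v * x ∈ ⋀[R]^(i + 1) (Fin n → R) := by
  rw [ExteriorAlgebra.exteriorPower, pow_succ']
  exact Submodule.mul_mem_mul ⟨v, rfl⟩ hx

theorem koszulDifferential_mem (i : ℕ) : ∀ x ∈ ⋀[R]^(i + 1) (Fin n → R),
    koszulDifferential φ x ∈ ⋀[R]^i (Fin n → R) := by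
  induction i with
  | zero =>
    intro x hx
    rw [ExteriorAlgebra.exteriorPower, pow_succ'] at hx
    refine Submodule.mul_induction_on hx ?_ fun x y hx hy ↦ by
      rw [map_add]
      exact add_mem hx hy
    rintro _ ⟨v, rfl⟩ y hy
    rw [koszulDifferential_ι_mul, koszulDifferential_of_mem_zero φ hy, mul_zero, sub_zero]
    exact Submodule.smul_mem _ _ hy
  | succ i ih =>
    intro x hx
    rw [ExteriorAlgebra.exteriorPower, pow_succ'] at hx
    refine Submodule.mul_induction_on hx ?_ fun x y hx hy ↦ by
      rw [map_add]
      exact add_mem hx hy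
    rintro _ ⟨v, rfl⟩ y hy
    rw [koszulDifferential_ι_mul]
    exact sub_mem (Submodule.smul_mem _ _ hy) (ι_mul_mem v (ih y hy))

theorem koszulDifferential_mem_grading (i j : ℤ) (h : j + 1 = i)
    (x : ExteriorAlgebra R (Fin n → R)) (hx : x ∈ exteriorGrading R n i) :
    koszulDifferential φ x ∈ exteriorGrading R n j := by
  subst h
  rcases lt_or_ge j 0 with hj | hj
  · rw [exteriorGrading_of_neg hj, Submodule.mem_bot]
    rcases lt_or_ge (j + 1) 0 with hj' | hj'
    · rw [exteriorGrading_of_neg hj', Submodule.mem_bot] at hx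
      rw [hx, map_zero]
    · have : j + 1 = (0 : ℕ) := by push_cast; omega
      rw [this, exteriorGrading_natCast] at hx
      exact koszulDifferential_of_mem_zero φ hx
  · obtain ⟨j, rfl⟩ := Int.eq_ofNat_of_zero_le hj
    rw [exteriorGrading_natCast]
    have : (j : ℤ) + 1 = (j + 1 : ℕ) := by push_cast; rfl
    rw [this, exteriorGrading_natCast] at hx
    exact koszulDifferential_mem φ j x hx

theorem ι_mul_mem_grading (v : Fin n → R) {i : ℤ} {x : ExteriorAlgebra R (Fin n → R)}
    (hx : x ∈ exteriorGrading R n i) :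
    ExteriorAlgebra.ι R v * x ∈ exteriorGrading R n (i + 1) := by
  rcases lt_or_ge i 0 with hi | hi
  · rw [exteriorGrading_of_neg hi, Submodule.mem_bot] at hx
    rw [hx, mul_zero]
    exact zero_mem _
  · obtain ⟨i, rfl⟩ := Int.eq_ofNat_of_zero_le hi
    rw [exteriorGrading_natCast] at hx
    have : (i : ℤ) + 1 = (i + 1 : ℕ) := by push_cast; rfl
    rw [this, exteriorGrading_natCast]
    exact ι_mul_mem v hx

/-- The residue field of a Noetherian local ring has a finite quasi-projective resolution, namely
the Koszul complex on generators of the maximal ideal. -/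
theorem qpl_residueField_lt_top (R : Type u) [CommRing R] [IsNoetherianRing R] [IsLocalRing R] :
    qpl R (ResidueField R) < ⊤ := by
  obtain ⟨n, x, hx⟩ := Submodule.fg_iff_exists_fin_generating_family.1
    (IsNoetherian.noetherian (maximalIdeal R))
  let φ : Module.Dual R (Fin n → R) := Fintype.linearCombination R x
  have hφ : ∀ r ∈ maximalIdeal R, ∃ v, φ v = r := by
    intro r hr
    have : r ∈ LinearMap.range (Fintype.linearCombination R x) := by
      rw [Fintype.range_linearCombination, hx]
      exact hr
    exact this
  have hφ' : ∀ v, φ v ∈ maximalIdeal R := by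
    intro v
    rw [← hx, ← Fintype.range_linearCombination]
    exact ⟨v, rfl⟩
  let P := gradedComplex (exteriorGrading R n) (koszulDifferential φ)
    (koszulDifferential_mem_grading φ) (koszulDifferential_koszulDifferential φ)
  have hom : ∀ i : ℤ, ∃ a : ℕ,
      Nonempty ((P.homology i : ModuleCat.{u} R) ≃ₗ[R] (Fin a → ResidueField R)) ∧
      (i = 0 → a ≠ 0) := by
    intro i
    let Z := exteriorGrading R n i ⊓ LinearMap.ker (koszulDifferential φ)
    let B : Submodule R Z :=
      ((exteriorGrading R n (i + 1)).map (koszulDifferential φ)).comap Z.subtype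
    obtain ⟨e⟩ := gradedComplex_homology (koszulDifferential_mem_grading φ)
      (koszulDifferential_koszulDifferential φ) i B.mkQ B.mkQ_surjective
      (fun z ↦ Submodule.Quotient.mk_eq_zero _)
    have := finite_exteriorGrading (R := R) n i
    have : Module.Finite R Z := .of_injective (Submodule.inclusion inf_le_left)
      (Submodule.inclusion_injective _)
    have hm : ∀ r ∈ maximalIdeal R, ∀ q : Z ⧸ B, r • q = 0 := by
      intro r hr q
      obtain ⟨z, rfl⟩ := B.mkQ_surjective q
      obtain ⟨v, rfl⟩ := hφ r hr
      rw [← map_smul]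
      -- On a cycle z the Leibniz rule reads d(v ∧ z) = φ(v) z, so every element of 𝔪 = im φ
      -- annihilates homology.
      refine (Submodule.Quotient.mk_eq_zero _).2
        ⟨ExteriorAlgebra.ι R v * z, ι_mul_mem_grading v z.2.1, ?_⟩
      rw [koszulDifferential_ι_mul, show koszulDifferential φ z = 0 from z.2.2, mul_zero, sub_zero]
      rfl
    obtain ⟨a, ⟨ea⟩⟩ := nonempty_equiv_residueField_pow hm
    refine ⟨a, ⟨e.trans ea⟩, ?_⟩
    -- Degree zero homology is nonzero: otherwise 1 would be a boundary φ(v), an element of 𝔪.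
    rintro rfl rfl
    have hsub : Subsingleton (Z ⧸ B) := ea.toEquiv.subsingleton
    have h1 : (1 : ExteriorAlgebra R (Fin n → R)) ∈ ⋀[R]^0 (Fin n → R) := by
      rw [ExteriorAlgebra.exteriorPower, pow_zero]
      exact Submodule.one_le.1 le_rfl
    have h1Z : (1 : ExteriorAlgebra R (Fin n → R)) ∈ Z :=
      ⟨by simp [exteriorGrading], koszulDifferential_of_mem_zero φ h1⟩
    obtain ⟨y, hy, hy1⟩ : (⟨1, h1Z⟩ : Z) ∈ B :=
      (Submodule.Quotient.mk_eq_zero _).1 (Subsingleton.elim (B.mkQ ⟨1, h1Z⟩) 0)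
    have hy' : y ∈ LinearMap.range (ExteriorAlgebra.ι R : (Fin n → R) →ₗ[R] _) := by
      simpa [exteriorGrading, ExteriorAlgebra.exteriorPower] using hy
    obtain ⟨v, rfl⟩ := hy'
    have h2 : koszulDifferential φ (ExteriorAlgebra.ι R v) = algebraMap R _ (φ v) :=
      CliffordAlgebra.contractLeft_ι 0 φ v
    rw [h2] at hy1
    have h3 : φ v = 1 := (ExteriorAlgebra.algebraMap_eq_one_iff (Fin n → R) _).1 hy1
    exact (Ideal.ne_top_iff_one _).1 (maximalIdeal.isMaximal R).ne_top (h3 ▸ hφ' v)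
  choose a ha h0 using hom
  have hb : ∀ i, Nontrivial (P.X i) → (0 : ℤ) ≤ i ∧ i ≤ n := by
    intro i hi
    have hi' : Nontrivial (exteriorGrading R n i) := hi
    by_contra h
    rcases lt_or_ge i 0 with h' | h'
    · rw [exteriorGrading_of_neg h'] at hi'
      exact not_subsingleton (⊥ : Submodule R (ExteriorAlgebra R (Fin n → R))) inferInstance
    · exact not_subsingleton _ (exteriorGrading_of_lt (R := R) (n := n) (i := i) (by omega))
  refine (qpl_le_of_bounds hb (.of_bounds hb (fun i ↦ projective_exteriorGrading n i)
    ⟨a, ⟨0, h0 0 rfl⟩, ha⟩)).trans_lt (EReal.coe_lt_top _)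

end Koszul

/-! ### Consequences of qpl k ≤ 1 -/

section ResidueField

open IsLocalRing

/-- A section of R → k sends 1 to a unit of R. That unit is killed by 𝔪, since 1 ∈ k is; hence 𝔪 =
0. -/
theorem isField_of_projective_residueField {R : Type u} [CommRing R] [IsLocalRing R]
    [Module.Projective R (ResidueField R)] : IsField R := by
  obtain ⟨s, hs⟩ := Module.projective_lifting_property (Algebra.linearMap R (ResidueField R))
    LinearMap.id residue_surjective
  have h1 : residue R (s 1) = 1 := congrArg (fun g ↦ g 1) hs
  have hu : IsUnit (s 1) := by
    rw [← residue_ne_zero_iff_isUnit, h1]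
    exact one_ne_zero
  rw [isField_iff_maximalIdeal_eq, eq_bot_iff]
  intro r hr
  have h2 : r • (1 : ResidueField R) = 0 := by
    rw [Algebra.smul_def, mul_one]
    exact (residue_eq_zero_iff r).2 hr
  have h3 : r * s 1 = 0 := by
    rw [← smul_eq_mul, ← map_smul, h2, map_zero]
  exact (hu.mul_left_eq_zero).1 h3

theorem isField_of_projective_residueField_pow {R : Type u} [CommRing R] [IsLocalRing R] {a : ℕ}
    (ha : a ≠ 0) (h : Module.Projective R (Fin a → ResidueField R)) : IsField R := by
  have : NeZero a := ⟨ha⟩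
  have : Module.Projective R (ResidueField R) :=
    .of_split (LinearMap.single R (fun _ : Fin a ↦ ResidueField R) 0) (LinearMap.proj 0)
      (by ext; simp)
  exact isField_of_projective_residueField

/-- A resolution of length 0 lives in one degree and equals its own homology there, so a nonzero
power of k is projective. -/
theorem isField_of_qpl_residueField_eq_zero {R : Type u} [CommRing R] [IsLocalRing R]
    (h : qpl R (ResidueField R) = 0) : IsField R := by
  obtain ⟨P, hP, t, s, hts, hb⟩ :=
    exists_resolution_of_qpl_le (R := R) (M := ResidueField R) (n := 0) (by simp [h])
  have hsub : ∀ i, i ≠ t → Subsingleton (P.X i) := by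
    intro i h0
    rw [← not_nontrivial_iff_subsingleton]
    intro hi
    have := hb i hi
    omega
  obtain ⟨a, ⟨i, hi⟩, ha⟩ := hP.homology
  obtain ⟨e⟩ := ha i
  have hit : i = t := by
    by_contra hcon
    have := hsub i hcon
    have := subsingleton_homology P i
    have : NeZero (a i) := ⟨hi⟩
    exact not_subsingleton (Fin (a i) → ResidueField R) e.symm.toEquiv.subsingleton
  subst hit
  have hs1 := hsub (i + 1) (by omega)
  have hs2 := hsub (i - 1) (by omega)
  obtain ⟨e'⟩ := nonempty_homology_equiv_of_surjective P (i + 1) i (i - 1) rfl (by ring)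
    (Submodule.subtype _) (fun z ↦ ⟨⟨z, Subsingleton.elim _ _⟩, rfl⟩) (fun z ↦ by
      constructor
      · intro hz
        exact ⟨0, by simpa using hz.symm⟩
      · rintro ⟨y, hy⟩
        rw [Subsingleton.elim y 0, map_zero] at hy
        exact hy.symm)
  have := hP.projective i
  exact isField_of_projective_residueField_pow hi (.of_equiv (e'.symm.trans e))

theorem exists_minimal_generators (R : Type u) [CommRing R] [IsNoetherianRing R]
    [IsLocalRing R] : ∃ (n : ℕ) (x : Fin n → R), Ideal.span (Set.range x) = maximalIdeal R ∧
      ∀ r : Fin n → R, ∑ i, r i * x i = 0 → ∀ i, r i ∈ maximalIdeal R := by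
  let b := Module.finBasis (ResidueField R) (CotangentSpace R)
  choose y hy using fun i ↦ (maximalIdeal R).toCotangent_surjective (b i)
  refine ⟨_, fun i ↦ y i, ?_, ?_⟩
  · have h1 : Submodule.span (ResidueField R)
        ((maximalIdeal R).toCotangent '' Set.range y) = ⊤ := by
      rw [← Set.range_comp, ← b.span_eq]
      congr 2
      ext i
      exact hy i
    rw [CotangentSpace.span_image_eq_top_iff] at h1
    have h2 := congrArg (Submodule.map (maximalIdeal R).subtype) h1
    rw [Submodule.map_span, Submodule.map_top, Submodule.range_subtype, ← Set.range_comp] at h2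
    exact h2
  · intro r hr i
    have h1 : ∑ i, r i • y i = 0 := by
      apply Subtype.ext
      simpa using hr
    have h2 : ∑ i, residue R (r i) • b i = 0 := by
      have := congrArg (maximalIdeal R).toCotangent h1
      rw [map_sum, map_zero] at this
      rw [← this]
      refine Finset.sum_congr rfl fun i _ ↦ ?_
      rw [map_smul, hy]
      rfl
    exact (residue_eq_zero_iff _).1 (Fintype.linearIndependent_iff.1 b.linearIndependent _ h2 i)

variable {R : Type u} [CommRing R] [IsLocalRing R]

theorem smul_eq_zero_of_equiv_residueField_pow {N : Type*} [AddCommGroup N] [Module R N] {a : ℕ}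
    (e : N ≃ₗ[R] (Fin a → ResidueField R)) {r : R} (hr : r ∈ maximalIdeal R) (x : N) :
    r • x = 0 := by
  apply e.injective
  ext i
  have h : algebraMap R (ResidueField R) r = 0 := (residue_eq_zero_iff r).2 hr
  rw [map_smul, map_zero, Pi.smul_apply, Algebra.smul_def, h, zero_mul, Pi.zero_apply]

/-- If the cokernel of a map of projective modules is a nonzero vector space and its kernel is a
vector space, then the first syzygy module of the maximal ideal is a vector space. -/
theorem smul_syzygy_eq_zero {F G : Type u} [AddCommGroup F] [Module R F] [AddCommGroup G]
    [Module R G] [Module.Projective R F] [Module.Projective R G] (f : F →ₗ[R] G) {a b : ℕ}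
    (hb : b ≠ 0) (ea : LinearMap.ker f ≃ₗ[R] (Fin a → ResidueField R))
    (eb : (G ⧸ LinearMap.range f) ≃ₗ[R] (Fin b → ResidueField R)) {n : ℕ} {x : Fin n → R}
    (hx : Ideal.span (Set.range x) = maximalIdeal R)
    (hmin : ∀ r : Fin n → R, ∑ i, r i * x i = 0 → ∀ i, r i ∈ maximalIdeal R)
    {z : Fin n → R} (hz : ∑ i, z i * x i = 0) {r : R} (hr : r ∈ maximalIdeal R) : r • z = 0 := by
  have : NeZero b := ⟨hb⟩
  let φ : (Fin n → R) →ₗ[R] R := Fintype.linearCombination R x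
  have hφ : ∀ v, φ v = ∑ i, v i * x i := fun v ↦ by
    simp [φ, Fintype.linearCombination_apply]
  have hφr : LinearMap.range φ = maximalIdeal R := by
    rw [Fintype.range_linearCombination]
    exact hx
  obtain ⟨g, hg⟩ := Submodule.mkQ_surjective _ (eb.symm (Pi.single 0 1))
  have hxg : ∀ i, ∃ y, f y = x i • g := by
    intro i
    have hxi : x i ∈ maximalIdeal R := by
      rw [← hx]
      exact Ideal.subset_span ⟨i, rfl⟩
    have := smul_eq_zero_of_equiv_residueField_pow eb hxi ((LinearMap.range f).mkQ g)
    rw [← map_smul] at this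
    exact (Submodule.Quotient.mk_eq_zero _).1 this
  choose y hy using hxg
  -- The map α covers R → G, 1 ↦ g, and β below covers β₀ : G → R, a lift of one coordinate of the
  -- cokernel. Together they compare φ : R^n → R with f in both directions.
  let α : (Fin n → R) →ₗ[R] F := Fintype.linearCombination R y
  have hα : ∀ v, f (α v) = φ v • g := by
    intro v
    simp only [α, Fintype.linearCombination_apply, map_sum, map_smul, hy, hφ, Finset.sum_smul,
      mul_smul]
  let q : G →ₗ[R] ResidueField R :=
    LinearMap.proj 0 ∘ₗ eb.toLinearMap ∘ₗ (LinearMap.range f).mkQ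
  obtain ⟨β₀, hβ₀⟩ := Module.projective_lifting_property (Algebra.linearMap R (ResidueField R))
    q residue_surjective
  have hβ₀' : ∀ w, residue R (β₀ w) = q w := fun w ↦ congrArg (fun h ↦ h w) hβ₀
  have hβf : ∀ w, β₀ (f w) ∈ LinearMap.range φ := by
    intro w
    rw [hφr, ← residue_eq_zero_iff, hβ₀']
    have : (LinearMap.range f).mkQ (f w) = 0 := (Submodule.Quotient.mk_eq_zero _).2 ⟨w, rfl⟩
    simp [q, this]
  obtain ⟨β, hβ⟩ := Module.projective_lifting_property φ.rangeRestrict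
    (LinearMap.codRestrict _ (β₀ ∘ₗ f) hβf) φ.surjective_rangeRestrict
  have hβ' : ∀ w, φ (β w) = β₀ (f w) := fun w ↦ congrArg (fun h ↦ (h w).1) hβ
  have hu : IsUnit (β₀ g) := by
    rw [← residue_ne_zero_iff_isUnit, hβ₀']
    have : q g = 1 := by
      change eb ((LinearMap.range f).mkQ g) 0 = 1
      rw [hg, eb.apply_symm_apply, Pi.single_eq_same]
    rw [this]
    exact one_ne_zero
  have hγ : ∀ v, φ (β (α v)) = φ v * β₀ g := by
    intro v
    rw [hβ', hα, map_smul, smul_eq_mul]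
  obtain ⟨c, hc⟩ := hu.exists_right_inv
  -- On R the composite is multiplication by the unit β₀ g, so β ∘ α is onto up to an error in ker
  -- φ. Minimality puts this error in 𝔪 R^n, and Nakayama's lemma applies.
  have hsurj : Function.Surjective (β ∘ₗ α) := by
    rw [← LinearMap.range_eq_top, eq_top_iff]
    refine Submodule.le_of_le_smul_of_le_jacobson_bot (I := maximalIdeal R)
      Module.Finite.fg_top (jacobson_eq_maximalIdeal ⊥ bot_ne_top).ge ?_
    intro v _
    have hv : v - β (α (c • v)) ∈ maximalIdeal R • (⊤ : Submodule R (Fin n → R)) := by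
      have h1 : φ (v - β (α (c • v))) = 0 := by
        rw [map_sub, hγ, map_smul, smul_eq_mul]
        linear_combination (-φ v) * hc
      rw [hφ] at h1
      have h2 := hmin _ h1
      rw [← Finset.univ_sum_single (v - β (α (c • v)))]
      refine sum_mem fun i _ ↦ ?_
      rw [show (Pi.single i ((v - β (α (c • v))) i) : Fin n → R) =
        ((v - β (α (c • v))) i) • Pi.single i (1 : R) by rw [← Pi.single_smul, smul_eq_mul, mul_one]]
      exact Submodule.smul_mem_smul (h2 i) trivial
    have := Submodule.add_mem_sup (LinearMap.mem_range_self (β ∘ₗ α) (c • v)) hv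
    rwa [LinearMap.comp_apply, add_sub_cancel] at this
  -- A syzygy is thus β (α z') with z' again a syzygy, and then α z' lies in ker f, which 𝔪 kills.
  obtain ⟨z', rfl⟩ := hsurj z
  rw [← hφ, LinearMap.comp_apply, hγ] at hz
  have hz' : φ z' = 0 := (hu.mul_left_eq_zero).1 hz
  have hker : α z' ∈ LinearMap.ker f := by
    rw [LinearMap.mem_ker, hα, hz', zero_smul]
  have h0 : r • α z' = 0 :=
    congrArg Subtype.val (smul_eq_zero_of_equiv_residueField_pow ea hr ⟨α z', hker⟩)
  rw [LinearMap.comp_apply, ← map_smul, h0, map_zero]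

/-- A surjection onto a projective module splits, so its kernel is a direct summand of F and k^a is
projective. -/
theorem isField_of_surjective_of_ker {F G : Type u} [AddCommGroup F] [Module R F] [AddCommGroup G]
    [Module R G] [Module.Projective R F] [Module.Projective R G] {f : F →ₗ[R] G} {a : ℕ}
    (ha : a ≠ 0) (hf : Function.Surjective f)
    (ea : LinearMap.ker f ≃ₗ[R] (Fin a → ResidueField R)) : IsField R := by
  obtain ⟨s, hs⟩ := Module.projective_lifting_property f LinearMap.id hf
  have hs' : ∀ w, f (s w) = w := fun w ↦ congrArg (fun h ↦ h w) hs
  have : Module.Projective R (LinearMap.ker f) :=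
    .of_split (LinearMap.ker f).subtype
      (LinearMap.codRestrict _ (LinearMap.id - s ∘ₗ f) fun w ↦ by simp [hs']) (by
        ext w
        simp)
  exact isField_of_projective_residueField_pow ha (.of_equiv ea)

theorem of_qpl_residueField_le_one [IsNoetherianRing R] (h : qpl R (ResidueField R) ≤ 1) :
    IsField R ∨ maximalIdeal R ^ 2 = ⊥ ∨ (maximalIdeal R).IsPrincipal := by
  obtain ⟨F, G, _, _, _, _, f, a, b, _, _, hab, ⟨ea⟩, ⟨eb⟩⟩ := exists_map_of_qpl_le_one h
  by_cases hb : b = 0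
  · subst hb
    have hsub := eb.toEquiv.subsingleton
    left
    refine isField_of_surjective_of_ker (hab.resolve_right (by simp)) ?_ ea
    rw [← LinearMap.range_eq_top]
    exact Submodule.Quotient.subsingleton_iff.1 hsub
  obtain ⟨n, x, hx, hmin⟩ := exists_minimal_generators R
  right
  rcases lt_or_ge n 2 with hn | hn
  · right
    have hn' : Subsingleton (Fin n) := Fin.subsingleton_iff_le_one.2 (by omega)
    rw [← hx]
    rcases isEmpty_or_nonempty (Fin n) with h0 | ⟨⟨i⟩⟩
    · rw [Set.range_eq_empty, Ideal.span_empty]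
      exact bot_isPrincipal
    · have : Set.range x = {x i} := by
        ext y
        exact ⟨fun ⟨j, hj⟩ ↦ by rw [← hj, Subsingleton.elim j i]; rfl, fun hy ↦ ⟨i, hy.symm⟩⟩
      exact ⟨x i, by rw [this]⟩
  · left
    have key : ∀ r ∈ maximalIdeal R, ∀ i, r * x i = 0 := by
      intro r hr i
      have : Nontrivial (Fin n) := Fin.nontrivial_iff_two_le.2 hn
      obtain ⟨j, hj⟩ := exists_ne i
      -- The Koszul relation between x_i and x_j, whose j-th coordinate is x_i.
      have h1 := smul_syzygy_eq_zero f hb ea eb hx hmin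
        (z := Pi.single j (x i) - Pi.single i (x j)) (by
          simp [sub_mul, Finset.sum_sub_distrib, Pi.single_apply, mul_comm (x i)]) hr
      have := congrFun h1 j
      simpa [hj] using this
    rw [eq_bot_iff, pow_two, Ideal.mul_le]
    intro r hr s hs
    rw [← hx] at hs
    refine Submodule.span_induction ?_ ?_ ?_ ?_ hs
    · rintro _ ⟨i, rfl⟩
      exact key r hr i
    · simp
    · intro s t _ _ hs ht
      rw [mul_add]
      exact add_mem hs ht
    · intro c s _ hs
      rw [smul_eq_mul, mul_left_comm]
      exact Ideal.mul_mem_left _ _ hs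

/-- A Noetherian local ring with principal maximal ideal is artinian or a discrete valuation
ring. -/
theorem isArtinianRing_or_isDiscreteValuationRing [IsNoetherianRing R]
    (h : (maximalIdeal R).IsPrincipal) :
    IsArtinianRing R ∨ ∃ _ : IsDomain R, IsDiscreteValuationRing R := by
  obtain ⟨x, hx⟩ := id h
  change maximalIdeal R = Ideal.span {x} at hx
  by_cases hnil : IsNilpotent x
  · left
    rw [isArtinianRing_iff_isNilpotent_maximalIdeal, hx]
    obtain ⟨n, hn⟩ := hnil
    exact ⟨n, by rw [Ideal.span_singleton_pow, hn, Ideal.zero_eq_bot, Ideal.span_singleton_eq_bot]⟩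
  right
  -- By Krull's intersection theorem a nonzero y lies in a last power of 𝔪 = (x), hence is a unit
  -- times a power of x. As x is not nilpotent, this excludes zero divisors.
  have hfac : ∀ y : R, y ≠ 0 → ∃ (n : ℕ) (u : R), IsUnit u ∧ y = x ^ n * u := by
    intro y hy
    have h1 : ∃ n, y ∉ maximalIdeal R ^ n := by
      by_contra! hcon
      have : y ∈ ⨅ n, maximalIdeal R ^ n := (Submodule.mem_iInf _).2 hcon
      rw [Ideal.iInf_pow_eq_bot_of_isLocalRing _ (maximalIdeal.isMaximal R).ne_top] at this
      exact hy this
    classical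
    obtain ⟨n, hn⟩ : ∃ n, Nat.find h1 = n + 1 :=
      Nat.exists_eq_succ_of_ne_zero fun h0 ↦ by
        have := Nat.find_spec h1
        rw [h0, pow_zero] at this
        exact this (by simp)
    have h2 := Nat.find_spec h1
    have h3 := Nat.find_min h1 (m := n) (by omega)
    rw [hn] at h2
    rw [not_not, hx, Ideal.span_singleton_pow, Ideal.mem_span_singleton] at h3
    obtain ⟨u, rfl⟩ := h3
    refine ⟨n, u, ?_, rfl⟩
    by_contra hu
    have hu' : u ∈ maximalIdeal R := hu
    rw [hx, Ideal.mem_span_singleton] at hu'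
    obtain ⟨v, rfl⟩ := hu'
    apply h2
    rw [hx, Ideal.span_singleton_pow, Ideal.mem_span_singleton]
    exact ⟨v, by ring⟩
  have hdom : IsDomain R := by
    have : NoZeroDivisors R := by
      refine ⟨fun {y z} hyz ↦ ?_⟩
      by_contra! hcon
      obtain ⟨n, u, hu, rfl⟩ := hfac y hcon.1
      obtain ⟨m, v, hv, rfl⟩ := hfac z hcon.2
      refine hnil ⟨n + m, ?_⟩
      rw [← (hu.mul hv).mul_left_eq_zero, pow_add, ← hyz]
      ring
    exact NoZeroDivisors.to_isDomain R
  refine ⟨hdom, ?_⟩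
  have hnf : ¬ IsField R := by
    rw [isField_iff_maximalIdeal_eq, hx, Ideal.span_singleton_eq_bot]
    rintro rfl
    exact hnil IsNilpotent.zero
  exact ((IsDiscreteValuationRing.TFAE R hnf).out 4 0).1 h

end ResidueField

/-! ### Invariance under isomorphism, and exact sequences -/

section Congruence

variable {R : Type u} [CommRing R] {M N : Type u} [AddCommGroup M] [Module R M] [AddCommGroup N]
  [Module R N]

theorem IsFiniteQuasiProjectiveResolution.congr (e : M ≃ₗ[R] N)
    {P : ChainComplex (ModuleCat.{u} R) ℤ} (h : IsFiniteQuasiProjectiveResolution M P) :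
    IsFiniteQuasiProjectiveResolution N P where
  boundedBelow := h.boundedBelow
  boundedAbove := h.boundedAbove
  projective := h.projective
  homology := by
    obtain ⟨a, ha, hh⟩ := h.homology
    refine ⟨a, ha, fun i ↦ ?_⟩
    obtain ⟨e'⟩ := hh i
    exact ⟨e'.trans (LinearEquiv.piCongrRight fun _ ↦ e)⟩

theorem qpl_congr (e : M ≃ₗ[R] N) : qpl R M = qpl R N := by
  have h1 : Nontrivial M ↔ Nontrivial N := e.toEquiv.nontrivial_congr
  have h2 : ∀ P : ChainComplex (ModuleCat.{u} R) ℤ,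
      IsFiniteQuasiProjectiveResolution M P ↔ IsFiniteQuasiProjectiveResolution N P :=
    fun P ↦ ⟨fun h ↦ h.congr e, fun h ↦ h.congr e.symm⟩
  simp only [qpl, h2]
  congr 1
  exact propext h1

theorem qpl_le_one_of_exact {F G : Type u} [AddCommGroup F] [Module R F] [AddCommGroup G]
    [Module R G] [Module.Projective R F] [Module.Projective R G] {a b : ℕ} (hab : a ≠ 0 ∨ b ≠ 0)
    (i : (Fin a → M) →ₗ[R] F) (f : F →ₗ[R] G) (p : G →ₗ[R] (Fin b → M))
    (hi : Function.Injective i) (hif : ∀ v, f v = 0 ↔ v ∈ LinearMap.range i)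
    (hfp : ∀ w, p w = 0 ↔ w ∈ LinearMap.range f) (hp : Function.Surjective p) :
    qpl R M ≤ 1 :=
  qpl_le_one_of_map f hab
    ((LinearEquiv.ofEq _ _ (Submodule.ext fun v ↦ hif v)).trans (LinearEquiv.ofInjective i hi).symm)
    ((Submodule.quotEquivOfEq _ _ (Submodule.ext fun w ↦ (hfp w).symm)).trans
      (p.quotKerEquivOfSurjective hp))

end Congruence

/-! ### Local rings with 𝔪² = 0 -/

section SquareZero

open IsLocalRing

variable {R : Type u} [CommRing R] [IsLocalRing R]

/-- An injective map of modules killed by the maximal ideal is split. -/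
theorem exists_leftInverse_of_smul_eq_zero {V W : Type*} [AddCommGroup V] [Module R V]
    [AddCommGroup W] [Module R W] (hV : ∀ r ∈ maximalIdeal R, ∀ x : V, r • x = 0)
    (hW : ∀ r ∈ maximalIdeal R, ∀ x : W, r • x = 0) (g : V →ₗ[R] W)
    (hg : Function.Injective g) : ∃ h : W →ₗ[R] V, h ∘ₗ g = LinearMap.id := by
  have htV : Module.IsTorsionBySet R V (maximalIdeal R : Set R) := fun x r ↦ hV r r.2 x
  have htW : Module.IsTorsionBySet R W (maximalIdeal R : Set R) := fun x r ↦ hW r r.2 x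
  let _ : Module (ResidueField R) V := htV.module
  let _ : Module (ResidueField R) W := htW.module
  have : IsScalarTower R (ResidueField R) V := htV.isScalarTower
  have : IsScalarTower R (ResidueField R) W := htW.isScalarTower
  obtain ⟨h, hh⟩ := (LinearMap.extendScalarsOfSurjective
    (residue_surjective : Function.Surjective (algebraMap R (ResidueField R)))
      g).exists_leftInverse_of_injective
    (LinearMap.ker_eq_bot.2 hg)
  exact ⟨h.restrictScalars R, LinearMap.ext fun x ↦ congrArg (fun l ↦ l x) hh⟩

theorem smul_quotient_eq_zero {Q : Type*} [AddCommGroup Q] [Module R Q] :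
    ∀ r ∈ maximalIdeal R, ∀ x : Q ⧸ (maximalIdeal R • (⊤ : Submodule R Q)), r • x = 0 := by
  intro r hr x
  obtain ⟨x, rfl⟩ := Submodule.mkQ_surjective _ x
  rw [← map_smul]
  exact (Submodule.Quotient.mk_eq_zero _).2 (Submodule.smul_mem_smul hr trivial)

/-- Realize Q as a retract of a free module. The coordinates of x there are killed by a nonzero
element of 𝔪, so they are nonunits. -/
theorem mem_smul_top_of_smul_eq_zero (hR : ¬ IsField R) {Q : Type*} [AddCommGroup Q] [Module R Q]
    [Module.Projective R Q] {x : Q} (hx : ∀ r ∈ maximalIdeal R, r • x = 0) :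
    x ∈ maximalIdeal R • (⊤ : Submodule R Q) := by
  obtain ⟨s, hs⟩ := Module.projective_def'.1 ‹Module.Projective R Q›
  have hx' : Finsupp.linearCombination R id (s x) = x := congrArg (fun l ↦ l x) hs
  rw [isField_iff_maximalIdeal_eq] at hR
  obtain ⟨r, hr, hr0⟩ := Submodule.exists_mem_ne_zero_of_ne_bot hR
  rw [← hx', Finsupp.linearCombination_apply]
  refine sum_mem fun q _ ↦ Submodule.smul_mem_smul ?_ trivial
  have h1 : r * s x q = 0 := by
    rw [← smul_eq_mul, ← Finsupp.smul_apply, ← map_smul, hx r hr, map_zero, Finsupp.zero_apply]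
  intro hu
  exact hr0 (hu.mul_left_eq_zero.1 h1)

theorem smul_eq_zero_of_mem_smul_top (h2 : maximalIdeal R ^ 2 = ⊥) {Q : Type*}
    [AddCommGroup Q] [Module R Q] {x : Q}
    (hx : x ∈ maximalIdeal R • (⊤ : Submodule R Q)) {r : R} (hr : r ∈ maximalIdeal R) :
    r • x = 0 := by
  have : r • x ∈ maximalIdeal R • (maximalIdeal R • (⊤ : Submodule R Q)) :=
    Submodule.smul_mem_smul hr hx
  rwa [← Submodule.mul_smul, ← pow_two, h2, Submodule.bot_smul, Submodule.mem_bot] at this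

/-- Over a local ring with square zero maximal ideal, an endomorphism that is the identity modulo
the maximal ideal has a left inverse. -/
theorem exists_leftInverse_of_sub_mem (h2 : maximalIdeal R ^ 2 = ⊥) {Q : Type*}
    [AddCommGroup Q] [Module R Q] (g : Q →ₗ[R] Q)
    (hg : ∀ x, x - g x ∈ maximalIdeal R • (⊤ : Submodule R Q)) :
    ∃ h : Q →ₗ[R] Q, h ∘ₗ g = LinearMap.id := by
  have h0 : ∀ x ∈ maximalIdeal R • (⊤ : Submodule R Q), x - g x = 0 := by
    intro x hx
    refine Submodule.smul_induction_on hx ?_ ?_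
    · intro r hr q _
      rw [map_smul, ← smul_sub]
      exact smul_eq_zero_of_mem_smul_top h2 (hg q) hr
    · intro x y hx hy
      rw [map_add, add_sub_add_comm, hx, hy, add_zero]
  -- The map id - g has image in 𝔪Q and vanishes on 𝔪Q, so its square is zero.
  refine ⟨LinearMap.id + (LinearMap.id - g), LinearMap.ext fun x ↦ ?_⟩
  have := h0 _ (hg x)
  simp only [LinearMap.comp_apply, LinearMap.add_apply, LinearMap.sub_apply, LinearMap.id_apply]
  rw [map_sub] at this
  rw [← sub_eq_zero, ← neg_eq_zero, ← this]
  abel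

/-- In a projective module, 𝔪Q is exactly the part killed by 𝔪, so f remains injective modulo 𝔪. A
left inverse of the reduction lifts by projectivity to σ with σ ∘ f ≡ id modulo 𝔪, and
`exists_leftInverse_of_sub_mem` corrects it. -/
theorem exists_leftInverse_of_injective (h2 : maximalIdeal R ^ 2 = ⊥) (hR : ¬ IsField R)
    {Q P : Type*} [AddCommGroup Q]
    [Module R Q] [AddCommGroup P] [Module R P] [Module.Projective R Q] [Module.Projective R P]
    (f : Q →ₗ[R] P) (hf : Function.Injective f) : ∃ h : P →ₗ[R] Q, h ∘ₗ f = LinearMap.id := by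
  let mQ := maximalIdeal R • (⊤ : Submodule R Q)
  let mP := maximalIdeal R • (⊤ : Submodule R P)
  have hmem : ∀ x, f x ∈ mP ↔ x ∈ mQ := by
    intro x
    constructor
    · intro hx
      refine mem_smul_top_of_smul_eq_zero hR fun r hr ↦ hf ?_
      rw [map_smul, map_zero]
      exact smul_eq_zero_of_mem_smul_top h2 hx hr
    · intro hx
      have : f x ∈ mQ.map f := ⟨x, hx, rfl⟩
      rw [Submodule.map_smul''] at this
      exact Submodule.smul_mono le_rfl le_top this
  obtain ⟨ρ, hρ⟩ := exists_leftInverse_of_smul_eq_zero smul_quotient_eq_zero smul_quotient_eq_zero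
    (mQ.mapQ mP f fun x hx ↦ (hmem x).2 hx) (by
      rw [← LinearMap.ker_eq_bot, Submodule.ker_mapQ, eq_bot_iff]
      rintro _ ⟨x, hx, rfl⟩
      exact (Submodule.Quotient.mk_eq_zero _).2 ((hmem x).1 hx))
  obtain ⟨σ, hσ⟩ := Module.projective_lifting_property mQ.mkQ (ρ ∘ₗ mP.mkQ) mQ.mkQ_surjective
  obtain ⟨h, hh⟩ := exists_leftInverse_of_sub_mem h2 (σ ∘ₗ f) fun x ↦ by
    rw [← Submodule.Quotient.mk_eq_zero, Submodule.Quotient.mk_sub, sub_eq_zero]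
    have h1 : mQ.mkQ (σ (f x)) = ρ (mP.mkQ (f x)) := congrArg (fun l ↦ l (f x)) hσ
    have h3 : ρ (mP.mkQ (f x)) = mQ.mkQ x := congrArg (fun l ↦ l (mQ.mkQ x)) hρ
    exact (h1.trans h3).symm
  exact ⟨h ∘ₗ σ, hh⟩

theorem projective_quotient_range {R : Type*} [CommRing R] {Q P : Type*} [AddCommGroup Q]
    [Module R Q] [AddCommGroup P] [Module R P] [Module.Projective R P] (f : Q →ₗ[R] P)
    (h : P →ₗ[R] Q) (hf : h ∘ₗ f = LinearMap.id) :
    Module.Projective R (P ⧸ LinearMap.range f) := by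
  have hf' : ∀ x, h (f x) = x := fun x ↦ congrArg (fun l ↦ l x) hf
  refine .of_split ((LinearMap.range f).liftQ (LinearMap.id - f ∘ₗ h) ?_)
    (LinearMap.range f).mkQ ?_
  · rintro _ ⟨x, rfl⟩
    simp [hf']
  · refine Submodule.linearMap_qext _ (LinearMap.ext fun x ↦ ?_)
    simp only [LinearMap.comp_apply, Submodule.mkQ_apply, Submodule.liftQ_apply,
      LinearMap.sub_apply, LinearMap.id_apply, Submodule.Quotient.mk_sub, sub_eq_self]
    exact (Submodule.Quotient.mk_eq_zero _).2 ⟨_, rfl⟩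

/-- Over a local ring with nonzero square zero maximal ideal, a module with a finite
quasi-projective resolution embeds in a projective module. -/
theorem exists_injective_of_resolution (h2 : maximalIdeal R ^ 2 = ⊥) (hR : ¬ IsField R)
    {M : Type u} [AddCommGroup M]
    [Module R M] [Nontrivial M] {P : ChainComplex (ModuleCat.{u} R) ℤ}
    (hP : IsFiniteQuasiProjectiveResolution M P) :
    ∃ (Q : Type u) (_ : AddCommGroup Q) (_ : Module R Q) (_ : Module.Projective R Q)
      (j : M →ₗ[R] Q), Function.Injective j := by
  obtain ⟨t, s, -, hb, -⟩ := hP.exists_top_bottom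
  obtain ⟨a, ⟨i₀, hi₀⟩, ha⟩ := hP.homology
  have hker : ∀ i : ℤ, ∀ z, (P.d (i + 1) i).hom z ∈ LinearMap.ker (P.d i (i - 1)).hom := by
    intro i z
    rw [LinearMap.mem_ker, ← ModuleCat.comp_apply, P.d_comp_d]
    rfl
  let D : ∀ i : ℤ, (P.X i ⧸ LinearMap.range (P.d (i + 1) i).hom) →ₗ[R] P.X (i - 1) := fun i ↦
    (LinearMap.range (P.d (i + 1) i).hom).liftQ (P.d i (i - 1)).hom (by
      rintro _ ⟨z, rfl⟩
      exact hker i z)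
  -- Descending from the top degree: while there is no homology, the cokernel in one degree injects
  -- into the next term. The injection splits, so the next cokernel is projective too.
  have hproj : ∀ n : ℕ, (∀ i : ℤ, s - n < i → a i = 0) →
      Module.Projective R (P.X (s - n) ⧸ LinearMap.range (P.d (s - n + 1) (s - n)).hom) := by
    intro n
    induction n with
    | zero =>
      intro _
      have hs : Subsingleton (P.X (s - (0 : ℕ) + 1)) := by
        rw [← not_nontrivial_iff_subsingleton]
        intro hi
        have := (hb _ hi).2
        push_cast at this
        omega
      have h0 : LinearMap.range (P.d (s - (0 : ℕ) + 1) (s - (0 : ℕ))).hom = ⊥ := by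
        rw [eq_bot_iff]
        rintro _ ⟨z, rfl⟩
        rw [Subsingleton.elim z 0, map_zero]
        exact zero_mem _
      have := hP.projective (s - (0 : ℕ))
      exact .of_equiv (Submodule.quotEquivOfEqBot _ h0).symm
    | succ n ih =>
      intro hn
      have := ih fun i hi ↦ hn i (by push_cast; omega)
      have := hP.projective (s - n - 1)
      have hinj : Function.Injective (D (s - n)) := by
        obtain ⟨e⟩ := ha (s - n)
        rw [hn (s - n) (by push_cast; omega)] at e
        obtain ⟨e'⟩ := nonempty_homology_equiv P (s - n + 1) (s - n) (s - n - 1) rfl (by ring)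
        have hsub := (e'.symm.trans e).toEquiv.subsingleton
        rw [Submodule.Quotient.subsingleton_iff] at hsub
        rw [← LinearMap.ker_eq_bot, Submodule.ker_liftQ, eq_bot_iff]
        rintro _ ⟨z, hz, rfl⟩
        have : (⟨z, hz⟩ : LinearMap.ker (P.d (s - n) (s - n - 1)).hom) ∈
            (LinearMap.range (P.d (s - n + 1) (s - n)).hom).comap (Submodule.subtype _) :=
          hsub ▸ trivial
        exact (Submodule.Quotient.mk_eq_zero _).2 this
      obtain ⟨h, hh⟩ := exists_leftInverse_of_injective h2 hR (D (s - n)) hinj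
      have := projective_quotient_range _ h hh
      rw [Submodule.range_liftQ] at this
      have e1 : s - (n + 1 : ℕ) = s - n - 1 := by push_cast; ring
      have e2 : s - n - 1 + 1 = s - n := by ring
      rw [e1, e2]
      exact this
  have hex : ∃ n : ℕ, a (s - n) ≠ 0 := by
    have : i₀ ≤ s := by
      by_contra hcon
      have : Subsingleton (P.X i₀) := by
        rw [← not_nontrivial_iff_subsingleton]
        intro hi
        have := (hb _ hi).2
        omega
      have := subsingleton_homology P i₀
      obtain ⟨e⟩ := ha i₀
      have : NeZero (a i₀) := ⟨hi₀⟩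
      exact not_subsingleton (Fin (a i₀) → M) e.symm.toEquiv.subsingleton
    exact ⟨(s - i₀).toNat, by rwa [Int.toNat_of_nonneg (by omega), sub_sub_cancel]⟩
  classical
  -- In the highest degree s - n with homology, a copy of M sits inside the projective cokernel.
  have hspec := Nat.find_spec hex
  have hmin := fun m ↦ Nat.find_min hex (m := m)
  set n := Nat.find hex
  have hQ := hproj n fun i hi ↦ by
    rcases lt_or_ge s i with h | h
    · have : Subsingleton (P.X i) := by
        rw [← not_nontrivial_iff_subsingleton]
        intro hi
        have := (hb _ hi).2
        omega
      have := subsingleton_homology P i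
      obtain ⟨e⟩ := ha i
      by_contra h0
      have : NeZero (a i) := ⟨h0⟩
      exact not_subsingleton (Fin (a i) → M) e.symm.toEquiv.subsingleton
    · by_contra h0
      refine hmin (s - i).toNat (by omega) ?_
      rwa [Int.toNat_of_nonneg (by omega), sub_sub_cancel]
  obtain ⟨e⟩ := ha (s - n)
  obtain ⟨e'⟩ := nonempty_homology_equiv P (s - n + 1) (s - n) (s - n - 1) rfl (by ring)
  have : NeZero (a (s - n)) := ⟨hspec⟩
  let Z := LinearMap.ker (P.d (s - n) (s - n - 1)).hom
  let B := LinearMap.range (P.d (s - n + 1) (s - n)).hom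
  let inc : (Z ⧸ B.comap Z.subtype) →ₗ[R] (P.X (s - n) ⧸ B) :=
    (B.comap Z.subtype).mapQ B Z.subtype le_rfl
  have hinc : Function.Injective inc := by
    rw [← LinearMap.ker_eq_bot, Submodule.ker_mapQ, eq_bot_iff]
    rintro _ ⟨z, hz, rfl⟩
    exact (Submodule.Quotient.mk_eq_zero _).2 hz
  refine ⟨_, inferInstance, inferInstance, hQ, inc ∘ₗ (e.symm.trans e').toLinearMap ∘ₗ
    LinearMap.single R (fun _ : Fin (a (s - n)) ↦ M) 0, ?_⟩
  exact hinc.comp ((e.symm.trans e').injective.comp (Pi.single_injective (M := fun _ ↦ M) 0))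

/-- Over a local ring with nonzero square zero maximal ideal, a finitely generated submodule of a
projective module is the sum of a free module and a vector space. -/
theorem exists_equiv_free_prod (h2 : maximalIdeal R ^ 2 = ⊥) {M Q : Type u} [AddCommGroup M]
    [Module R M] [Module.Finite R M] [AddCommGroup Q] [Module R Q] [Module.Projective R Q]
    (j : M →ₗ[R] Q) (hj : Function.Injective j) :
    ∃ c y : ℕ, Nonempty (M ≃ₗ[R] (Fin c → R) × (Fin y → ResidueField R)) := by
  let mQ := maximalIdeal R • (⊤ : Submodule R Q)
  let S : Submodule R M := mQ.comap j
  have hS : ∀ x ∈ S, ∀ r ∈ maximalIdeal R, r • x = 0 := fun x hx r hr ↦ hj (by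
    rw [map_smul, map_zero]
    exact smul_eq_zero_of_mem_smul_top h2 hx hr)
  have hV : ∀ r ∈ maximalIdeal R, ∀ x : M ⧸ S, r • x = 0 := by
    intro r hr x
    obtain ⟨x, rfl⟩ := Submodule.mkQ_surjective _ x
    rw [← map_smul]
    refine (Submodule.Quotient.mk_eq_zero _).2 ?_
    change j (r • x) ∈ mQ
    rw [map_smul]
    exact Submodule.smul_mem_smul hr trivial
  obtain ⟨c, ⟨e⟩⟩ := nonempty_equiv_residueField_pow hV
  obtain ⟨ρ, hρ⟩ := exists_leftInverse_of_smul_eq_zero hV smul_quotient_eq_zero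
    (S.mapQ mQ j le_rfl) (by
      rw [← LinearMap.ker_eq_bot, Submodule.ker_mapQ, eq_bot_iff]
      rintro _ ⟨x, hx, rfl⟩
      exact (Submodule.Quotient.mk_eq_zero _).2 hx)
  let red : (Fin c → R) →ₗ[R] (Fin c → ResidueField R) :=
    (Algebra.linearMap R (ResidueField R)).compLeft (Fin c)
  have hred : Function.Surjective red := fun v ↦ by
    choose w hw using fun i ↦ residue_surjective (v i)
    exact ⟨w, funext hw⟩
  have hred0 : ∀ v, red v = 0 → v ∈ maximalIdeal R • (⊤ : Submodule R (Fin c → R)) := by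
    intro v hv
    rw [← Finset.univ_sum_single v]
    refine sum_mem fun i _ ↦ ?_
    rw [show (Pi.single i (v i) : Fin c → R) = v i • Pi.single i (1 : R) by
      rw [← Pi.single_smul, smul_eq_mul, mul_one]]
    exact Submodule.smul_mem_smul ((residue_eq_zero_iff _).1 (congrFun hv i)) trivial
  obtain ⟨α, hα⟩ := Module.projective_lifting_property S.mkQ (e.symm.toLinearMap ∘ₗ red)
    S.mkQ_surjective
  obtain ⟨Θ, hΘ⟩ := Module.projective_lifting_property red (e.toLinearMap ∘ₗ ρ ∘ₗ mQ.mkQ) hred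
  have hα' : ∀ v, e (S.mkQ (α v)) = red v := fun v ↦ by
    have : S.mkQ (α v) = e.symm (red v) := congrArg (fun l ↦ l v) hα
    rw [this, e.apply_symm_apply]
  have hΘ' : ∀ x, red (Θ (j x)) = e (S.mkQ x) := fun x ↦ by
    have h1 : red (Θ (j x)) = e (ρ (mQ.mkQ (j x))) := congrArg (fun l ↦ l (j x)) hΘ
    have h3 : ρ (mQ.mkQ (j x)) = S.mkQ x := congrArg (fun l ↦ l (S.mkQ x)) hρ
    rw [h1, h3]
  -- The map α lifts a basis of M/S, and Θ ∘ j retracts it modulo 𝔪; hence R^c splits off M.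
  obtain ⟨h, hh⟩ := exists_leftInverse_of_sub_mem h2 (Θ ∘ₗ j ∘ₗ α) fun v ↦ hred0 _ (by
    rw [map_sub, LinearMap.comp_apply, LinearMap.comp_apply, hΘ', hα', sub_self])
  let π : M →ₗ[R] (Fin c → R) := h ∘ₗ Θ ∘ₗ j
  have hπ : ∀ v, π (α v) = v := fun v ↦ congrArg (fun l ↦ l v) hh
  -- An element w of the complement agrees with some α v modulo S, so r w = α (r v). Applying π
  -- gives r v = 0, hence r w = 0.
  have hW : ∀ r ∈ maximalIdeal R, ∀ w : LinearMap.ker π, r • w = 0 := by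
    rintro r hr ⟨w, hw⟩
    apply Subtype.ext
    change r • w = 0
    obtain ⟨v, hv⟩ := hred (e (S.mkQ w))
    have h1 : w - α v ∈ S := by
      rw [← Submodule.Quotient.mk_eq_zero]
      apply e.injective
      change e (S.mkQ (w - α v)) = _
      rw [map_sub, map_sub, hα', hv, sub_self, map_zero]
    have h3 := hS _ h1 r hr
    have h4 : r • v = 0 := by
      have := congrArg π h3
      rw [map_zero, map_smul, map_sub, hπ, LinearMap.mem_ker.1 hw, zero_sub, smul_neg,
        neg_eq_zero] at this
      exact this
    rwa [smul_sub, ← map_smul, h4, map_zero, sub_zero] at h3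
  have : Module.Finite R (LinearMap.ker π) := by
    refine .of_surjective (LinearMap.codRestrict (LinearMap.ker π) (LinearMap.id - α ∘ₗ π)
      fun x ↦ by simp [hπ]) ?_
    rintro ⟨w, hw⟩
    exact ⟨w, Subtype.ext (by simp [LinearMap.mem_ker.1 hw])⟩
  obtain ⟨y, ⟨ey⟩⟩ := nonempty_equiv_residueField_pow hW
  refine ⟨c, y, ⟨?_⟩⟩
  let e1 : M ≃ₗ[R] (Fin c → R) × LinearMap.ker π := LinearEquiv.ofLinearMap
    (π.prod (LinearMap.codRestrict (LinearMap.ker π) (LinearMap.id - α ∘ₗ π)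
      fun x ↦ by simp [hπ]))
    (α.coprod (LinearMap.ker π).subtype)
    (by
      refine LinearMap.ext ?_
      rintro ⟨v, w, hw⟩
      have hw' : π w = 0 := hw
      refine Prod.ext ?_ (Subtype.ext ?_) <;> simp [hπ, hw'])
    (by
      ext x
      simp)
  exact e1.trans ((LinearEquiv.refl R (Fin c → R)).prodCongr ey)

/-- Since 𝔪² = 0, the syzygies of 𝔪 form a vector space k^d. So y copies of R^n → R have kernel
(k^y)^d and cokernel k^y; adding the zero map (R^c)^d → R^c turns these into M^d and M. -/
theorem qpl_free_prod_le_one (h2 : maximalIdeal R ^ 2 = ⊥) [IsNoetherianRing R] (c y : ℕ) :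
    qpl R ((Fin c → R) × (Fin y → ResidueField R)) ≤ 1 := by
  obtain ⟨n, x, hx, hmin⟩ := exists_minimal_generators R
  let φ : (Fin n → R) →ₗ[R] R := Fintype.linearCombination R x
  have hφ : ∀ v, φ v = ∑ i, v i * x i := fun v ↦ by
    simp [φ, Fintype.linearCombination_apply]
  have hφr : LinearMap.range φ = maximalIdeal R := by
    rw [Fintype.range_linearCombination]
    exact hx
  have hK : ∀ r ∈ maximalIdeal R, ∀ v : LinearMap.ker φ, r • v = 0 := by
    rintro r hr ⟨v, hv⟩
    apply Subtype.ext
    ext i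
    have h1 : v i ∈ maximalIdeal R := hmin v (by rw [← hφ]; exact hv) i
    have h3 : r * v i ∈ maximalIdeal R ^ 2 := by
      rw [pow_two]
      exact Ideal.mul_mem_mul hr h1
    rw [h2] at h3
    exact h3
  have : Module.Finite R (LinearMap.ker φ) := inferInstance
  obtain ⟨d, ⟨e⟩⟩ := nonempty_equiv_residueField_pow (R := R) (N := LinearMap.ker φ) hK
  let ι : (Fin d → ResidueField R) →ₗ[R] (Fin n → R) :=
    (LinearMap.ker φ).subtype ∘ₗ e.symm.toLinearMap
  have hι : Function.Injective ι := Subtype.val_injective.comp e.symm.injective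
  have hιφ : ∀ v, φ v = 0 → ∃ w, ι w = v := fun v hv ↦ ⟨e ⟨v, hv⟩, by simp [ι]⟩
  have hφι : ∀ w, φ (ι w) = 0 := fun w ↦ (e.symm w).2
  let M := (Fin c → R) × (Fin y → ResidueField R)
  let F := (Fin y → Fin n → R) × (Fin d → Fin c → R)
  let G := (Fin c → R) × (Fin y → R)
  let i : (Fin d → M) →ₗ[R] F :=
    { toFun := fun m ↦ (fun j ↦ ι fun l ↦ (m l).2 j, fun l ↦ (m l).1)
      map_add' := fun m m' ↦ Prod.ext (funext fun j ↦ ι.map_add _ _) rfl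
      map_smul' := fun r m ↦ Prod.ext (funext fun j ↦ ι.map_smul _ _) rfl }
  let f : F →ₗ[R] G := LinearMap.inr R _ _ ∘ₗ φ.compLeft (Fin y) ∘ₗ LinearMap.fst R _ _
  let p : G →ₗ[R] (Fin 1 → M) := LinearMap.pi fun _ ↦
    LinearMap.prodMap LinearMap.id ((Algebra.linearMap R (ResidueField R)).compLeft (Fin y))
  refine qpl_le_one_of_exact (Or.inr one_ne_zero) i f p ?_ ?_ ?_ ?_
  · intro m m' h
    funext l
    refine Prod.ext (congrFun (congrArg Prod.snd h) l) (funext fun j ↦ ?_)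
    exact congrFun (hι (congrFun (congrArg Prod.fst h) j)) l
  · rintro ⟨v, w⟩
    constructor
    · intro h
      have h' : ∀ j, φ (v j) = 0 := fun j ↦ congrFun (congrArg Prod.snd h) j
      choose z hz using fun j ↦ hιφ _ (h' j)
      exact ⟨fun l ↦ (w l, fun j ↦ z j l), Prod.ext (funext hz) rfl⟩
    · rintro ⟨m, h⟩
      have h' : ∀ j, φ (v j) = 0 := fun j ↦ by
        have : ι (fun l ↦ (m l).2 j) = v j := congrFun (congrArg Prod.fst h) j
        rw [← this, hφι]
      exact Prod.ext rfl (funext h')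
  · rintro ⟨v, w⟩
    constructor
    · intro h
      have h1 := congrFun h 0
      have h3 : v = 0 := congrArg Prod.fst h1
      have h4 : ∀ j, w j ∈ LinearMap.range φ := fun j ↦ by
        rw [hφr]
        exact (residue_eq_zero_iff _).1 (congrFun (congrArg Prod.snd h1) j)
      choose z hz using h4
      exact ⟨(z, 0), Prod.ext h3.symm (funext hz)⟩
    · rintro ⟨⟨z, z'⟩, h⟩
      have h3 : v = 0 := (congrArg Prod.fst h).symm
      funext l
      refine Prod.ext h3 (funext fun j ↦ (residue_eq_zero_iff _).2 ?_)
      rw [← hφr]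
      exact ⟨z j, congrFun (congrArg Prod.snd h) j⟩
  · intro m
    choose w hw using fun j ↦ residue_surjective ((m 0).2 j)
    refine ⟨((m 0).1, w), funext fun l ↦ ?_⟩
    rw [Subsingleton.elim l 0]
    exact Prod.ext rfl (funext hw)

theorem qpl_le_one_of_sq_eq_bot [IsNoetherianRing R] (hR : ¬ IsField R)
    (h2 : maximalIdeal R ^ 2 = ⊥) {M : Type u} [AddCommGroup M] [Module R M] [Module.Finite R M]
    (h : qpl R M < ⊤) : qpl R M ≤ 1 := by
  rcases subsingleton_or_nontrivial M with hM | hM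
  · rw [qpl_of_subsingleton]
    exact bot_le
  obtain ⟨P, hP⟩ := exists_resolution_of_qpl_lt_top h
  obtain ⟨Q, _, _, _, j, hj⟩ := exists_injective_of_resolution h2 hR hP
  obtain ⟨c, y, ⟨e⟩⟩ := exists_equiv_free_prod h2 j hj
  rw [qpl_congr e]
  exact qpl_free_prod_le_one h2 c y

end SquareZero

/-! ### Principal ideal domains and their quotients -/

section PrincipalIdealDomain

variable {R : Type u} [CommRing R]

theorem qpl_le_one_of_isPrincipalIdealRing [IsDomain R] [IsPrincipalIdealRing R] (M : Type u)
    [AddCommGroup M] [Module R M] [Module.Finite R M] : qpl R M ≤ 1 := by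
  obtain ⟨n, π, hπ⟩ := Module.Finite.exists_fin' R M
  let e : M ≃ₗ[R] (Fin 1 → M) := (LinearEquiv.funUnique (Fin 1) R M).symm
  refine qpl_le_one_of_exact (a := 0) (b := 1) (Or.inr one_ne_zero) 0
    (LinearMap.ker π).subtype (e.toLinearMap ∘ₗ π) (fun _ _ _ ↦ Subsingleton.elim _ _) ?_ ?_
    (e.surjective.comp hπ)
  · intro v
    simp
  · intro w
    simp

/-- With M = S^c/K, the submodule K is free and contains fS^c. The inclusion K ⊆ S^c induces K/fK →
S^c/fS^c with cokernel M and kernel fS^c/fK, and the latter is again M because f is a nonzerodivisor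
on S^c. -/
theorem qpl_le_one_of_quotient {S : Type*} [CommRing S] [IsDomain S] [IsPrincipalIdealRing S]
    (σ : S →+* R) (hσ : Function.Surjective σ) {f : S} (hf : f ≠ 0)
    (hker : ∀ s, σ s = 0 ↔ f ∣ s) (M : Type u)
    [AddCommGroup M] [Module R M] [Module.Finite R M] : qpl R M ≤ 1 := by
  obtain ⟨c, π, hπ⟩ := Module.Finite.exists_fin' R M
  let g : (Fin c → S) → M := fun v ↦ π (σ ∘ v)
  have hg_add : ∀ v w, g (v + w) = g v + g w := fun v w ↦ by
    have : σ ∘ (v + w) = σ ∘ v + σ ∘ w := funext fun i ↦ map_add σ _ _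
    simp only [g, this, map_add]
  have hg_smul : ∀ (s : S) v, g (s • v) = σ s • g v := fun s v ↦ by
    have : σ ∘ (s • v) = σ s • (σ ∘ v) := funext fun i ↦ map_mul σ _ _
    simp only [g, this, map_smul]
  have hg : Function.Surjective g := fun m ↦ by
    obtain ⟨w, rfl⟩ := hπ m
    choose v hv using fun i ↦ hσ (w i)
    exact ⟨v, congrArg π (funext hv)⟩
  let K : Submodule S (Fin c → S) :=
    { carrier := {v | g v = 0}
      add_mem' := fun {v w} hv hw ↦ by
        change g (v + w) = 0
        rw [hg_add, hv, hw, add_zero]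
      zero_mem' := by
        change g 0 = 0
        have := hg_smul 0 0
        rwa [map_zero, zero_smul, zero_smul] at this
      smul_mem' := fun s v hv ↦ by
        change g (s • v) = 0
        rw [hg_smul, hv, smul_zero] }
  obtain ⟨n, b⟩ := Submodule.basisOfPid (Pi.basisFun S (Fin c)) K
  have hσ0 : ∀ w : Fin c → S, σ ∘ w = 0 → ∃ v, w = f • v := fun w hw ↦ by
    choose v hv using fun i ↦ (hker _).1 (congrFun hw i)
    exact ⟨v, funext hv⟩
  have hσf : σ f = 0 := (hker f).2 dvd_rfl
  have hfK : ∀ v, f • v ∈ K := fun v ↦ by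
    change g (f • v) = 0
    rw [hg_smul, hσf, zero_smul]
  -- The class of f v in K/fK, in coordinates. It vanishes exactly when f v ∈ fK, that is when v ∈
  -- K, so it descends to an injection κ on M.
  let T : (Fin c → S) → (Fin n → R) := fun v i ↦ σ (b.repr ⟨f • v, hfK v⟩ i)
  have hT_add : ∀ v w, T (v + w) = T v + T w := fun v w ↦ by
    have : (⟨f • (v + w), hfK _⟩ : K) = ⟨f • v, hfK v⟩ + ⟨f • w, hfK w⟩ :=
      Subtype.ext (smul_add _ _ _)
    funext i
    simp only [T, this, map_add, Finsupp.add_apply, Pi.add_apply]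
  have hT_smul : ∀ (s : S) v, T (s • v) = σ s • T v := fun s v ↦ by
    have : (⟨f • s • v, hfK _⟩ : K) = s • ⟨f • v, hfK v⟩ := Subtype.ext (smul_comm _ _ _)
    funext i
    simp only [T, this, map_smul, Finsupp.smul_apply, Pi.smul_apply, smul_eq_mul, map_mul]
  have hT0 : ∀ v, T v = 0 ↔ g v = 0 := by
    intro v
    constructor
    · intro h
      choose w hw using fun i ↦ (hker _).1 (congrFun h i)
      have h1 : (⟨f • v, hfK v⟩ : K) = f • ∑ i, w i • b i := by
        rw [← b.sum_repr ⟨f • v, hfK v⟩, Finset.smul_sum]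
        exact Finset.sum_congr rfl fun i _ ↦ by rw [hw, mul_smul]
      have h3 : v = (∑ i, w i • b i : K) := smul_right_injective _ hf (congrArg Subtype.val h1)
      rw [h3]
      exact (∑ i, w i • b i : K).2
    · intro h
      have : (⟨f • v, hfK _⟩ : K) = f • ⟨v, h⟩ := rfl
      funext i
      simp only [T, this, map_smul, Finsupp.smul_apply, smul_eq_mul, map_mul, hσf, zero_mul,
        Pi.zero_apply]
  have hT : ∀ v w, g v = g w → T v = T w := by
    intro v w h
    have h1 : g (v - w) = 0 := by
      have := hg_add (v - w) w
      rw [sub_add_cancel, h] at this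
      exact left_eq_add.1 ((add_comm _ _).trans this.symm).symm
    have h3 := hT_add (v - w) w
    rwa [(hT0 _).2 h1, sub_add_cancel, zero_add] at h3
  choose l hl using hg
  let κ : M →ₗ[R] (Fin n → R) :=
    { toFun := fun m ↦ T (l m)
      map_add' := fun m m' ↦ by
        rw [← hT_add]
        exact hT _ _ (by rw [hg_add, hl, hl, hl])
      map_smul' := fun r m ↦ by
        obtain ⟨s, rfl⟩ := hσ r
        rw [RingHom.id_apply, ← hT_smul]
        exact hT _ _ (by rw [hg_smul, hl, hl]) }
  let φ : (Fin n → R) →ₗ[R] (Fin c → R) := Fintype.linearCombination R fun i ↦ σ ∘ (b i : Fin c → S)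
  have hφ : ∀ w : Fin n → S, φ (σ ∘ w) = σ ∘ (∑ i, w i • b i : K) := by
    intro w
    funext j
    simp [φ, Fintype.linearCombination_apply, Finset.sum_apply]
  let e : M ≃ₗ[R] (Fin 1 → M) := (LinearEquiv.funUnique (Fin 1) R M).symm
  refine qpl_le_one_of_exact (a := 1) (b := 1) (Or.inr one_ne_zero) (κ ∘ₗ e.symm.toLinearMap) φ
    (e.toLinearMap ∘ₗ π) ?_ ?_ ?_ (e.surjective.comp hπ)
  · have : Function.Injective κ := by
      rw [injective_iff_map_eq_zero]
      intro m hm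
      rw [← hl m]
      exact (hT0 _).1 hm
    exact this.comp e.symm.injective
  · intro v
    rw [LinearMap.range_comp, LinearEquiv.range, Submodule.map_top]
    constructor
    · intro hv
      choose w hw using fun i ↦ hσ (v i)
      obtain rfl : σ ∘ w = v := funext hw
      rw [hφ] at hv
      obtain ⟨z, hz⟩ := hσ0 _ hv
      refine ⟨g z, (hT (l (g z)) z (hl _)).trans (funext fun i ↦ congrArg σ ?_)⟩
      have : (⟨f • z, hfK z⟩ : K) = ∑ i, w i • b i := Subtype.ext hz.symm
      rw [this, b.repr_sum_self]
    · rintro ⟨m, rfl⟩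
      have : κ m = σ ∘ b.repr ⟨f • l m, hfK _⟩ := rfl
      rw [this, hφ, b.sum_repr]
      funext j
      simp [hσf]
  · intro w
    rw [LinearMap.comp_apply, LinearEquiv.coe_coe, LinearEquiv.map_eq_zero_iff]
    constructor
    · intro hw
      choose v hv using fun i ↦ hσ (w i)
      obtain rfl : σ ∘ v = w := funext hv
      refine ⟨σ ∘ b.repr ⟨v, hw⟩, ?_⟩
      rw [hφ, b.sum_repr]
    · rintro ⟨v, rfl⟩
      choose w hw using fun i ↦ hσ (v i)
      obtain rfl : σ ∘ w = v := funext hw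
      rw [hφ]
      exact (∑ i, w i • b i : K).2

end PrincipalIdealDomain

/-! ### Artinian hypersurfaces as quotients of discrete valuation rings -/

section Hypersurface

open IsLocalRing

variable {R : Type u} [CommRing R] [IsLocalRing R]

theorem isAdicComplete_of_isNilpotent {A : Type*} [CommRing A] {I : Ideal A} (h : IsNilpotent I) :
    IsAdicComplete I A := by
  obtain ⟨N, hN⟩ := h
  have hN' : ∀ n, N ≤ n → (I ^ n • ⊤ : Ideal A) = ⊥ := fun n hn ↦ by
    rw [pow_eq_zero_of_le hn hN, Ideal.zero_eq_bot, Submodule.bot_smul]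
  exact
    { haus' := fun x hx ↦ by
        have := hx N
        rwa [hN' N le_rfl, SModEq.bot] at this
      prec' := fun f hf ↦ ⟨f N, fun n ↦ by
        rcases le_total n N with h | h
        · exact hf h
        · have := hf h
          rw [hN' N le_rfl, SModEq.bot] at this
          rw [this]⟩ }

theorem nonempty_equiv_adicCompletion [IsArtinianRing R] :
    Nonempty (R ≃+* AdicCompletion (maximalIdeal R) R) := by
  have := isAdicComplete_of_isNilpotent
    (isArtinianRing_iff_isNilpotent_maximalIdeal R |>.1 inferInstance)
  exact ⟨(AdicCompletion.ofAlgEquiv (maximalIdeal R)).toRingEquiv⟩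

/-- An artinian local ring is its own completion, so R = S/(f) has dimension 0 and dim S ≤ 1.
Regularity makes the maximal ideal of S principal. S is not artinian, since the nonzerodivisor f
would then be a unit. -/
theorem IsHypersurface.exists_discreteValuationRing [IsArtinianRing R] (h : IsHypersurface R) :
    ∃ (S : Type u) (_ : CommRing S) (_ : IsDomain S) (_ : IsDiscreteValuationRing S) (σ : S →+* R)
      (f : S), Function.Surjective σ ∧ f ≠ 0 ∧ ∀ s, σ s = 0 ↔ f ∣ s := by
  obtain ⟨S, _, _, f, hf, ⟨e⟩⟩ := h
  obtain ⟨e'⟩ := nonempty_equiv_adicCompletion (R := R)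
  let eS : (S ⧸ Ideal.span {f}) ≃+* R := (e'.trans e).symm
  have : Nontrivial (S ⧸ Ideal.span {f}) := eS.toEquiv.nontrivial
  have hfu : ¬ IsUnit f := fun hu ↦ by
    exact (Ideal.Quotient.nontrivial_iff.1 this) (Ideal.span_singleton_eq_top.2 hu)
  have hdim : ringKrullDim S ≤ 1 := by
    have h1 := ringKrullDim_le_ringKrullDim_quotient_add_spanFinrank (Ideal.span {f}) (by
      rw [Ring.jacobson_eq_sInf_isMaximal]
      refine le_sInf fun I hI ↦ ?_
      rw [IsLocalRing.eq_maximalIdeal hI, Ideal.span_singleton_le_iff_mem]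
      exact hfu)
    have h2 : ringKrullDim (S ⧸ Ideal.span {f}) = 0 := by
      rw [ringKrullDim_eq_of_ringEquiv eS]
      exact ringKrullDimZero_iff_ringKrullDim_eq_zero.1 inferInstance
    have h3 : (Ideal.span {f}).spanFinrank ≤ 1 := by
      simpa using Submodule.spanFinrank_span_le_ncard_of_finite (R := S) (Set.finite_singleton f)
    rw [h2, zero_add] at h1
    exact h1.trans (by exact_mod_cast h3)
  have hprin : (maximalIdeal S).IsPrincipal := by
    rw [← (isRegularLocalRing_iff S).1 inferInstance] at hdim
    have h1 : (maximalIdeal S).spanFinrank ≤ 1 := by exact_mod_cast hdim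
    rcases Nat.le_one_iff_eq_zero_or_eq_one.1 h1 with h0 | h0
    · rw [(Submodule.spanFinrank_eq_zero_iff_eq_bot (IsNoetherian.noetherian _)).1 h0]
      exact bot_isPrincipal
    · exact ((Submodule.spanFinrank_eq_one_iff _).1 h0).1
  rcases isArtinianRing_or_isDiscreteValuationRing hprin with hA | ⟨hd, hv⟩
  · exact (hfu (IsArtinianRing.isUnit_of_mem_nonZeroDivisors hf)).elim
  · refine ⟨S, inferInstance, hd, hv, eS.toRingHom.comp (Ideal.Quotient.mk _), f,
      eS.surjective.comp Ideal.Quotient.mk_surjective, nonZeroDivisors.ne_zero hf, fun s ↦ ?_⟩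
    rw [← Ideal.mem_span_singleton, ← Ideal.Quotient.eq_zero_iff_mem]
    exact eS.map_eq_zero_iff

/-- The kernel is principal, and nonzero because a discrete valuation ring is not artinian. -/
theorem isHypersurface_of_surjective [IsArtinianRing R] {S : Type u} [CommRing S] [IsDomain S]
    [IsDiscreteValuationRing S] (σ : S →+* R) (hσ : Function.Surjective σ) : IsHypersurface R := by
  obtain ⟨e'⟩ := nonempty_equiv_adicCompletion (R := R)
  obtain ⟨f, hf⟩ := IsPrincipalIdealRing.principal (RingHom.ker σ)
  change RingHom.ker σ = Ideal.span {f} at hf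
  refine ⟨S, inferInstance, inferInstance, f, ?_, ⟨e'.symm.trans ?_⟩⟩
  · rw [mem_nonZeroDivisors_iff_ne_zero]
    rintro rfl
    rw [Ideal.span_singleton_eq_bot.2 rfl, ← RingHom.injective_iff_ker_eq_bot] at hf
    have : IsArtinianRing S :=
      (RingEquiv.ofBijective σ ⟨hf, hσ⟩).symm.isArtinianRing
    exact IsDiscreteValuationRing.not_isField S
      (IsArtinianRing.isField_of_isDomain S)
  · exact ((Ideal.quotEquivOfEq hf.symm).trans (RingHom.quotientKerEquivOfSurjective hσ)).symm

end Hypersurface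

/-! ### Lifting homomorphisms along nilpotent ideals -/

section Lifting

open Polynomial

/-- If `b ^ p` lies in a subfield of which `b` is not congruent to an element, then adjoining `b`
yields a subfield. -/
theorem eval₂_eq_zero_or_isUnit {F E : Type*} [Field F] [CommRing E] {p : ℕ} (hp : p.Prime)
    (i : F →+* E) {b : E} {c : F} (hc : i c = b ^ p) (hd : ∀ d : F, d ^ p ≠ c) (g : F[X]) :
    eval₂ i b g = 0 ∨ ∃ u : F[X], eval₂ i b g * eval₂ i b u = 1 := by
  have hirr := X_pow_sub_C_irreducible_of_prime hp hd
  have h0 : eval₂ i b (X ^ p - C c) = 0 := by simp [hc]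
  by_cases h : X ^ p - C c ∣ g
  · left
    obtain ⟨q, rfl⟩ := h
    rw [eval₂_mul, h0, zero_mul]
  · right
    obtain ⟨v, u, huv⟩ := (hirr.coprime_iff_not_dvd.2 h)
    refine ⟨u, ?_⟩
    have := congrArg (eval₂ i b) huv
    rwa [eval₂_add, eval₂_mul, h0, mul_zero, zero_add, eval₂_mul, eval₂_one, mul_comm] at this

/-- A square zero extension in characteristic `p` of a field is split. -/
theorem exists_section_of_sq_zero {k E : Type*} [Field k] [CommRing E] {p : ℕ} (hp : p.Prime)
    (hpE : (p : E) = 0) (π : E →+* k) (hπ : Function.Surjective π)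
    (hsq : ∀ x y, π x = 0 → π y = 0 → x * y = 0) :
    ∃ σ : k →+* E, ∀ x, π (σ x) = x := by
  have : Fact p.Prime := ⟨hp⟩
  have : Nontrivial E := π.domain_nontrivial
  have hcE : CharP E p := by
    have := CharP.exists E
    obtain ⟨q, hq⟩ := this
    rcases (Nat.dvd_prime hp).1 ((CharP.cast_eq_zero_iff E q p).1 hpE) with h | h
    · rw [h] at hq
      exact (CharP.char_ne_one E 1 rfl).elim
    · rwa [← h]
  have hck : CharP k p := by
    have : (p : k) = 0 := by rw [← map_natCast π, hpE, map_zero]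
    obtain ⟨q, hq⟩ := CharP.exists k
    rcases (Nat.dvd_prime hp).1 ((CharP.cast_eq_zero_iff k q p).1 this) with h | h
    · rw [h] at hq
      exact (CharP.char_ne_one k 1 rfl).elim
    · rwa [← h]
  have hpow : ∀ x, π x = 0 → x ^ p = 0 := fun x hx ↦ by
    obtain ⟨m, hm⟩ := Nat.exists_eq_add_of_le hp.two_le
    rw [hm, pow_add, pow_two, hsq x x hx hx, zero_mul]
  -- Subfields of E containing all p-th powers. The image of Frobenius is one, since Frobenius kills
  -- ker π; a maximal one will map isomorphically onto k.
  let 𝒯 : Set (Subring E) :=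
    {T | (∀ x : E, x ^ p ∈ T) ∧ ∀ x ∈ T, x ≠ 0 → ∃ y ∈ T, x * y = 1}
  have h0 : (frobenius E p).range ∈ 𝒯 := by
    refine ⟨fun x ↦ ⟨x, rfl⟩, ?_⟩
    rintro _ ⟨x, rfl⟩ hx
    have hx' : π x ≠ 0 := fun h ↦ hx (hpow x h)
    obtain ⟨y, hy⟩ := hπ (π x)⁻¹
    refine ⟨y ^ p, ⟨y, rfl⟩, ?_⟩
    rw [frobenius_def, ← mul_pow]
    have h1 : π (x * y - 1) = 0 := by
      rw [map_sub, map_mul, hy, mul_inv_cancel₀ hx', map_one, sub_self]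
    have h2 := hpow _ h1
    rwa [sub_pow_char, one_pow, sub_eq_zero] at h2
  obtain ⟨T, -, hT⟩ := zorn_le_nonempty₀ 𝒯 (fun c hc hchain T₀ hT₀ ↦ by
    refine ⟨sSup c, ⟨fun x ↦ ?_, fun x hx hx0 ↦ ?_⟩, fun _ ↦ le_sSup⟩
    · exact (le_sSup hT₀ : T₀ ≤ sSup c) ((hc hT₀).1 x)
    · rw [Subring.mem_sSup_of_directedOn ⟨T₀, hT₀⟩ hchain.directedOn] at hx
      obtain ⟨T, hT, hxT⟩ := hx
      obtain ⟨y, hy, hxy⟩ := (hc hT).2 x hxT hx0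
      exact ⟨y, (le_sSup hT : T ≤ sSup c) hy, hxy⟩) _ h0
  have hTfield : IsField T :=
    { exists_pair_ne := ⟨0, 1, zero_ne_one⟩
      mul_comm := mul_comm
      mul_inv_cancel := fun {x} hx ↦ by
        obtain ⟨y, hy, hxy⟩ := hT.prop.2 x x.2 fun h ↦ hx (Subtype.ext h)
        exact ⟨⟨y, hy⟩, Subtype.ext hxy⟩ }
  let _ : Field T := hTfield.toField
  have hsurj : ∀ b : k, ∃ x ∈ T, π x = b := by
    intro b
    by_contra! hb
    obtain ⟨x, rfl⟩ := hπ b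
    -- Adjoining x gives a larger member: x^p lies in T but has no p-th root there, since such a
    -- root d would satisfy π d = π x by injectivity of Frobenius on k.
    let T' : Subring E := (eval₂RingHom T.subtype x).range
    have hTT' : T ≤ T' := fun y hy ↦ ⟨C ⟨y, hy⟩, by simp⟩
    have hT' : T' ∈ 𝒯 := by
      refine ⟨fun y ↦ hTT' (hT.prop.1 y), ?_⟩
      rintro _ ⟨g, rfl⟩ hg
      rcases eval₂_eq_zero_or_isUnit hp T.subtype (b := x) (c := ⟨x ^ p, hT.prop.1 x⟩) rfl
        (fun d hd ↦ by
          have h1 : (d : E) ^ p = x ^ p := congrArg Subtype.val hd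
          have h2 : π d ^ p = π x ^ p := by rw [← map_pow, h1, map_pow]
          exact hb d d.2 (frobenius_inj k p h2)) g with h | ⟨u, hu⟩
      · exact (hg h).elim
      · exact ⟨_, ⟨u, rfl⟩, hu⟩
    exact hb x (hT.le_of_ge hT' hTT' ⟨X, by simp⟩) rfl
  have hbij : Function.Bijective (π.comp T.subtype) :=
    ⟨RingHom.injective _, fun b ↦ by
      obtain ⟨x, hx, hxb⟩ := hsurj b
      exact ⟨⟨x, hx⟩, hxb⟩⟩
  exact ⟨T.subtype.comp (RingEquiv.ofBijective _ hbij).symm.toRingHom,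
    (RingEquiv.ofBijective _ hbij).apply_symm_apply⟩

/-- A `p`-torsion free ring whose reduction modulo `p` is a field has the lifting property for
square zero extensions whose kernel is killed by `p`. -/
theorem exists_lift_of_sq_zero {C k B B' : Type*} [CommRing C] [Field k] [CommRing B]
    [CommRing B'] {p : ℕ} (hp : p.Prime) (htf : ∀ c : C, (p : C) * c = 0 → c = 0)
    (ρ : C →+* k) (hρ : Function.Surjective ρ) (hker : ∀ c, ρ c = 0 ↔ (p : C) ∣ c)
    (q : B →+* B') (hq : Function.Surjective q) (hsq : ∀ x y, q x = 0 → q y = 0 → x * y = 0)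
    (hpq : ∀ x, q x = 0 → (p : B) * x = 0) (ψ : C →+* B') :
    ∃ ψ' : C →+* B, ∀ c, q (ψ' c) = ψ c := by
  -- The fibre product of C and B over B'. Modulo p it is a square-zero extension of k, which splits
  -- by `exists_section_of_sq_zero`.
  let E : Subring (C × B) :=
    (ψ.comp (RingHom.fst C B)).eqLocus (q.comp (RingHom.snd C B))
  have hE : ∀ e : E, ψ e.1.1 = q e.1.2 := fun e ↦ e.2
  have hlift : ∀ c, ∃ e : E, e.1.1 = c := fun c ↦ by
    obtain ⟨b, hb⟩ := hq (ψ c)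
    exact ⟨⟨(c, b), hb.symm⟩, rfl⟩
  let J : Ideal E := Ideal.span {(p : E)}
  let r : E →+* k := ρ.comp ((RingHom.fst C B).comp E.subtype)
  have hr : ∀ e : E, r e = ρ e.1.1 := fun _ ↦ rfl
  have hmk : ∀ e : E, r e = 0 → ∃ e' : E, e'.1.1 = 0 ∧
      Ideal.Quotient.mk J e = Ideal.Quotient.mk J e' := fun e he ↦ by
    obtain ⟨c, hc⟩ := (hker _).1 he
    replace hc : e.1.1 = (p : C) * c := hc
    obtain ⟨e₁, he₁⟩ := hlift c
    refine ⟨e - p * e₁, ?_, ?_⟩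
    · change e.1.1 - (p : C) * e₁.1.1 = 0
      rw [hc, he₁, sub_self]
    · rw [Ideal.Quotient.eq, sub_sub_cancel]
      exact Ideal.mul_mem_right _ _ (Ideal.mem_span_singleton_self _)
  have hrp : ∀ e ∈ J, r e = 0 := fun e he ↦ by
    obtain ⟨e', rfl⟩ := Ideal.mem_span_singleton.1 he
    rw [map_mul, map_natCast, ← map_natCast ρ, (hker _).2 dvd_rfl, zero_mul]
  obtain ⟨σ, hσ⟩ := exists_section_of_sq_zero hp (E := E ⧸ J)
    (by
      rw [← map_natCast (Ideal.Quotient.mk J)]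
      exact Ideal.Quotient.eq_zero_iff_mem.2 (Ideal.mem_span_singleton_self _))
    (Ideal.Quotient.lift J r hrp)
    (Ideal.Quotient.lift_surjective_of_surjective _ _ fun a ↦ by
      obtain ⟨c, rfl⟩ := hρ a
      obtain ⟨e, rfl⟩ := hlift c
      exact ⟨e, rfl⟩)
    (fun x y hx hy ↦ by
      obtain ⟨x, rfl⟩ := Ideal.Quotient.mk_surjective x
      obtain ⟨y, rfl⟩ := Ideal.Quotient.mk_surjective y
      rw [Ideal.Quotient.lift_mk] at hx hy
      obtain ⟨x', hx', hxx⟩ := hmk x hx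
      obtain ⟨y', hy', hyy⟩ := hmk y hy
      rw [hxx, hyy, ← map_mul]
      have : x' * y' = 0 := Subtype.ext (Prod.ext
        (by
          change x'.1.1 * y'.1.1 = 0
          rw [hx', zero_mul])
        (hsq _ _ (by rw [← hE, hx', map_zero]) (by rw [← hE, hy', map_zero])))
      rw [this, map_zero])
  -- The preimage of the split copy of k in E/pE. It maps isomorphically to C: an element over 0 is
  -- p e, torsion-freeness puts e over 0, and p kills ker q. The inverse followed by the projection
  -- to B is the lift.
  let D : Subring E := (Ideal.Quotient.mk J).eqLocus (σ.comp r)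
  have hD : ∀ d : D, Ideal.Quotient.mk J d.1 = σ (r d.1) := fun d ↦ d.2
  let f : D →+* C := (RingHom.fst C B).comp (E.subtype.comp D.subtype)
  have hf : Function.Bijective f := by
    constructor
    · rw [injective_iff_map_eq_zero]
      intro d hd
      have hd' : d.1.1.1 = 0 := hd
      have h1 : Ideal.Quotient.mk J d.1 = 0 := by
        rw [hD, hr, hd', map_zero, map_zero]
      obtain ⟨e, he⟩ := Ideal.mem_span_singleton.1 (Ideal.Quotient.eq_zero_iff_mem.1 h1)
      have h2 : e.1.1 = 0 := htf _ (by
        have : d.1.1.1 = (p : C) * e.1.1 := congrArg (fun z : E ↦ z.1.1) he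
        rw [← this, hd'])
      have h3 : d.1.1.2 = (p : B) * e.1.2 := congrArg (fun z : E ↦ z.1.2) he
      rw [hpq _ (by rw [← hE, h2, map_zero])] at h3
      exact Subtype.ext (Subtype.ext (Prod.ext hd' h3))
    · intro c
      obtain ⟨e, rfl⟩ := hlift c
      obtain ⟨e₁, he₁⟩ := Ideal.Quotient.mk_surjective (σ (r e))
      have h1 : r e₁ = r e := by
        have := hσ (r e)
        rwa [← he₁, Ideal.Quotient.lift_mk] at this
      obtain ⟨e', he', hee⟩ := hmk (e₁ - e) (by rw [map_sub, h1, sub_self])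
      refine ⟨⟨e + e', ?_⟩, ?_⟩
      · change Ideal.Quotient.mk J (e + e') = σ (r (e + e'))
        have h2 : r e' = 0 := by rw [hr, he', map_zero]
        rw [map_add r, h2, add_zero, map_add, ← hee, map_sub, add_sub_cancel, he₁]
      · change e.1.1 + e'.1.1 = e.1.1
        rw [he', add_zero]
  let g := (RingEquiv.ofBijective f hf).symm
  refine ⟨(RingHom.snd C B).comp (E.subtype.comp (D.subtype.comp g.toRingHom)), fun c ↦ ?_⟩
  have h1 := hE (g c).1
  have h2 : (g c).1.1.1 = c := (RingEquiv.ofBijective f hf).apply_symm_apply c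
  rw [h2] at h1
  exact h1.symm

/-- Lift through the rings B/I^(n+1) in turn: each kernel I^(n+1)/I^(n+2) has square zero and is
killed by I, which contains p. -/
theorem exists_lift_of_isNilpotent {C k B : Type*} [CommRing C] [Field k] [CommRing B]
    {p : ℕ} (hp : p.Prime) (htf : ∀ c : C, (p : C) * c = 0 → c = 0)
    (ρ : C →+* k) (hρ : Function.Surjective ρ) (hker : ∀ c, ρ c = 0 ↔ (p : C) ∣ c)
    {I : Ideal B} (hI : IsNilpotent I) (hpI : (p : B) ∈ I) (ψ : C →+* B ⧸ I) :
    ∃ ψ' : C →+* B, ∀ c, Ideal.Quotient.mk I (ψ' c) = ψ c := by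
  have key : ∀ n : ℕ, ∃ ψ' : C →+* B ⧸ I ^ (n + 1), ∀ c,
      Ideal.Quotient.factor (Ideal.pow_le_self n.succ_ne_zero) (ψ' c) = ψ c := by
    intro n
    induction n with
    | zero =>
      refine ⟨(Ideal.Quotient.factor (by rw [zero_add, pow_one])).comp ψ, fun c ↦ ?_⟩
      obtain ⟨b, hb⟩ := Ideal.Quotient.mk_surjective (ψ c)
      rw [RingHom.comp_apply, ← hb, Ideal.Quotient.factor_mk, Ideal.Quotient.factor_mk]
    | succ n ih =>
      obtain ⟨φ, hφ⟩ := ih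
      have hle : I ^ (n + 1 + 1) ≤ I ^ (n + 1) := Ideal.pow_le_pow_right (Nat.le_succ _)
      have hmem : ∀ x, Ideal.Quotient.factor hle x = 0 →
          ∃ b ∈ I ^ (n + 1), Ideal.Quotient.mk _ b = x := fun x hx ↦ by
        obtain ⟨b, rfl⟩ := Ideal.Quotient.mk_surjective x
        rw [Ideal.Quotient.factor_mk, Ideal.Quotient.eq_zero_iff_mem] at hx
        exact ⟨b, hx, rfl⟩
      have hkill : ∀ a ∈ I, ∀ b ∈ I ^ (n + 1),
          Ideal.Quotient.mk (I ^ (n + 1 + 1)) a * Ideal.Quotient.mk _ b = 0 := fun a ha b hb ↦ by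
        rw [← map_mul, Ideal.Quotient.eq_zero_iff_mem, pow_succ']
        exact Ideal.mul_mem_mul ha hb
      obtain ⟨ψ', hψ'⟩ := exists_lift_of_sq_zero hp htf ρ hρ hker (Ideal.Quotient.factor hle)
        (Ideal.Quotient.factor_surjective hle)
        (fun x y hx hy ↦ by
          obtain ⟨a, ha, rfl⟩ := hmem x hx
          obtain ⟨b, hb, rfl⟩ := hmem y hy
          exact hkill a (Ideal.pow_le_self n.succ_ne_zero ha) b hb)
        (fun x hx ↦ by
          obtain ⟨b, hb, rfl⟩ := hmem x hx
          rw [← map_natCast (Ideal.Quotient.mk (I ^ (n + 1 + 1)))]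
          exact hkill _ hpI b hb) φ
      refine ⟨ψ', fun c ↦ ?_⟩
      rw [← hφ, ← hψ']
      obtain ⟨b, hb⟩ := Ideal.Quotient.mk_surjective (ψ' c)
      rw [← hb, Ideal.Quotient.factor_mk, Ideal.Quotient.factor_mk, Ideal.Quotient.factor_mk]
  obtain ⟨n, hn⟩ := hI
  obtain ⟨φ, hφ⟩ := key n
  have hn' : I ^ (n + 1) ≤ ⊥ := by rw [pow_succ, hn, zero_mul, Ideal.zero_eq_bot]
  let e : B ⧸ I ^ (n + 1) →+* B :=
    Ideal.Quotient.lift _ (RingHom.id B) fun a ha ↦ (Ideal.mem_bot).1 (hn' ha)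
  refine ⟨e.comp φ, fun c ↦ ?_⟩
  rw [← hφ]
  obtain ⟨b, hb⟩ := Ideal.Quotient.mk_surjective (φ c)
  rw [RingHom.comp_apply, ← hb, Ideal.Quotient.factor_mk, Ideal.Quotient.lift_mk, RingHom.id_apply]

/-- In characteristic zero k is separable algebraic over a purely transcendental extension of ℚ,
hence formally smooth over ℚ. -/
theorem exists_lift_of_charZero {k B : Type*} [Field k] [CharZero k] [CommRing B] [Algebra ℚ B]
    {I : Ideal B} (hI : IsNilpotent I) (ψ : k →+* B ⧸ I) :
    ∃ ψ' : k →+* B, ∀ c, Ideal.Quotient.mk I (ψ' c) = ψ c := by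
  obtain ⟨s, hs⟩ := exists_isTranscendenceBasis ℚ k
  have := hs.isAlgebraic_field
  have : Algebra.FormallySmooth ℚ k :=
    .of_algebraicIndependent_of_isSeparable hs.1
  obtain ⟨f, hf⟩ := Algebra.FormallySmooth.exists_lift (R := ℚ) I hI ψ.toRatAlgHom
  exact ⟨f.toRingHom, fun c ↦ congrArg (fun g ↦ g c) hf⟩

end Lifting

/-! ### Discrete valuation rings with uniformizer p and prescribed residue field -/

section CohenRing

open Polynomial

/-- A local domain `V` with residue map `res` is root closed if every root of the reduction of a
monic polynomial lifts to a root. -/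
def IsRootClosed {V κ : Type*} [CommRing V] [Field κ] (res : V →+* κ) : Prop :=
  ∀ f : V[X], f.Monic → ∀ a : κ, (f.map res).eval a = 0 → ∃ α, f.eval α = 0 ∧ res α = a

/-- A monic polynomial over V has a root in Ω, which is integral and so lies in V. Split off that
linear factor; if its root does not reduce to a, then a is a root of the reduced quotient, of
smaller degree. -/
theorem isRootClosed_valuationSubring {Ω : Type*} [Field Ω] [IsAlgClosed Ω]
    (V : ValuationSubring Ω) : IsRootClosed (IsLocalRing.residue V) := by
  intro f
  induction hn : f.natDegree generalizing f with
  | zero =>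
    intro hf a ha
    rw [hf.natDegree_eq_zero.1 hn] at ha
    simp at ha
  | succ n ih =>
    intro hf a ha
    have hdeg : (f.map (algebraMap V Ω)).degree ≠ 0 := by
      rw [hf.degree_map, degree_eq_natDegree hf.ne_zero, hn]
      exact_mod_cast n.succ_ne_zero
    obtain ⟨z, hz⟩ := IsAlgClosed.exists_root _ hdeg
    have hint : IsIntegral V z := ⟨f, hf, by rwa [IsRoot, Polynomial.eval_map] at hz⟩
    obtain ⟨α, rfl⟩ := IsIntegrallyClosed.algebraMap_eq_of_integral hint
    have hα : f.eval α = 0 := by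
      rw [IsRoot, eval_map_algebraMap, aeval_algebraMap_apply] at hz
      simpa using hz
    by_cases hres : IsLocalRing.residue V α = a
    · exact ⟨α, hα, hres⟩
    obtain ⟨q, hq⟩ := dvd_iff_isRoot.2 hα
    have hqm : q.Monic := (monic_X_sub_C α).of_mul_monic_left (hq ▸ hf)
    have hqn : q.natDegree = n := by
      have := (monic_X_sub_C α).natDegree_mul hqm
      rw [← hq, hn, natDegree_X_sub_C] at this
      omega
    rw [hq, Polynomial.map_mul, eval_mul, mul_eq_zero] at ha
    obtain ⟨β, hβ, hβa⟩ := ih q hqn hqm a (ha.resolve_left (by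
      simp only [Polynomial.map_sub, map_X, map_C, eval_sub, eval_X, eval_C]
      exact sub_ne_zero.2 (Ne.symm hres)))
    exact ⟨β, by rw [hq, eval_mul, hβ, mul_zero], hβa⟩

/-- Every field embeds in the residue field of a root closed local domain of characteristic
zero. -/
theorem exists_isRootClosed (k : Type u) [Field k] :
    ∃ (V κ : Type u) (_ : CommRing V) (_ : IsDomain V) (_ : CharZero V) (_ : Field κ)
      (res : V →+* κ) (_ : k →+* κ), Function.Surjective res ∧ (∀ x, res x ≠ 0 → IsUnit x) ∧
      IsRootClosed res := by
  -- A polynomial ring over ℤ surjects onto k with prime kernel q. A valuation ring of the algebraic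
  -- closure of Frac A dominating A_q has characteristic zero, and its residue field contains A/q =
  -- k.
  let A := MvPolynomial k ℤ
  let ε : A →+* k := MvPolynomial.eval₂Hom (Int.castRingHom k) id
  have hε : Function.Surjective ε := fun a ↦ ⟨MvPolynomial.X a, MvPolynomial.eval₂Hom_X' _ _ a⟩
  let q : Ideal A := RingHom.ker ε
  have hq : q.IsPrime := RingHom.ker_isPrime ε
  let K := FractionRing A
  let Ω := AlgebraicClosure K
  have hinj : Function.Injective (algebraMap A Ω) := by
    rw [IsScalarTower.algebraMap_eq A K Ω]
    exact (algebraMap K Ω).injective.comp (IsFractionRing.injective A K)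
  let h : Localization.AtPrime q →+* Ω := IsLocalization.lift (M := q.primeCompl)
    (g := algebraMap A Ω) fun y ↦ by
      rw [isUnit_iff_ne_zero, Ne, map_eq_zero_iff _ hinj]
      rintro h0
      exact y.2 (h0 ▸ zero_mem q)
  obtain ⟨V, hV, hloc⟩ := IsLocalRing.exists_factor_valuationRing h
  let θ : A →+* V := (h.codRestrict V.toSubring hV).comp (algebraMap A (Localization.AtPrime q))
  have hθ : ∀ x, ε x = 0 → IsLocalRing.residue V (θ x) = 0 := by
    intro x hx
    rw [IsLocalRing.residue_eq_zero_iff]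
    intro hu
    have h1 : IsUnit (algebraMap A (Localization.AtPrime q) x) := hloc.map_nonunit _ hu
    rw [IsLocalization.AtPrime.isUnit_to_map_iff (Localization.AtPrime q) q] at h1
    exact h1 hx
  let j : k →+* IsLocalRing.ResidueField V :=
    (Ideal.Quotient.lift q ((IsLocalRing.residue V).comp θ) hθ).comp
      (RingHom.quotientKerEquivOfSurjective hε).symm.toRingHom
  have hcz : CharZero V := by
    have h1 : CharZero Ω := charZero_of_injective_algebraMap hinj
    exact ⟨fun a b hab ↦ by simpa using congrArg (algebraMap V Ω) hab⟩
  exact ⟨V, IsLocalRing.ResidueField V, inferInstance, inferInstance, hcz, inferInstance,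
    IsLocalRing.residue V, j, IsLocalRing.residue_surjective,
    fun x hx ↦ (IsLocalRing.residue_ne_zero_iff_isUnit x).1 hx, isRootClosed_valuationSubring V⟩

variable {V κ k : Type u} [CommRing V] [Field κ] [Field k]

/-- A subring of `V` that is a discrete valuation ring with uniformizer `p` and residue field
contained in `k`. -/
structure IsUnramifiedSubring (p : ℕ) (res : V →+* κ) (j : k →+* κ) (C : Subring V) : Prop where
  factor : ∀ x ∈ C, x ≠ 0 → ∃ n : ℕ, ∃ u ∈ C, ∃ w ∈ C, u * w = 1 ∧ x = (p : V) ^ n * u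
  residue : ∀ x ∈ C, res x ∈ j.fieldRange

variable {p : ℕ} {res : V →+* κ} {j : k →+* κ}

/-- C is the localization of D at its elements of nonzero residue, formed inside V, where they are
units. -/
theorem exists_isUnramifiedSubring_of_le [IsDomain V]
    (hloc : ∀ x, res x ≠ 0 → IsUnit x) (D : Subring V)
    (hD : ∀ x ∈ D, x ≠ 0 → ∃ n : ℕ, ∃ y ∈ D, res y ≠ 0 ∧ x = (p : V) ^ n * y)
    (hr : ∀ x ∈ D, res x ∈ j.fieldRange) : ∃ C, D ≤ C ∧ IsUnramifiedSubring p res j C := by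
  have hinv : ∀ x, res x ≠ 0 → ∃ y, x * y = 1 := fun x hx ↦ (hloc x hx).exists_right_inv
  let C : Subring V :=
    { carrier := {x | ∃ g ∈ D, ∃ h ∈ D, res h ≠ 0 ∧ x * h = g}
      mul_mem' := by
        rintro x y ⟨g, hg, h, hh, hh0, hx⟩ ⟨g', hg', h', hh', hh0', hy⟩
        exact ⟨g * g', D.mul_mem hg hg', h * h', D.mul_mem hh hh', by
          rw [map_mul]
          exact mul_ne_zero hh0 hh0', by rw [← hx, ← hy]; ring⟩
      one_mem' := ⟨1, D.one_mem, 1, D.one_mem, by simp, by simp⟩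
      add_mem' := by
        rintro x y ⟨g, hg, h, hh, hh0, hx⟩ ⟨g', hg', h', hh', hh0', hy⟩
        exact ⟨g * h' + g' * h, D.add_mem (D.mul_mem hg hh') (D.mul_mem hg' hh), h * h',
          D.mul_mem hh hh', by
            rw [map_mul]
            exact mul_ne_zero hh0 hh0', by rw [← hx, ← hy]; ring⟩
      zero_mem' := ⟨0, D.zero_mem, 1, D.one_mem, by simp, by simp⟩
      neg_mem' := by
        rintro x ⟨g, hg, h, hh, hh0, hx⟩
        exact ⟨-g, D.neg_mem hg, h, hh, hh0, by rw [← hx]; ring⟩ }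
  refine ⟨C, fun x hx ↦ ⟨x, hx, 1, D.one_mem, by simp, by simp⟩, ?_, ?_⟩
  · rintro x ⟨g, hg, h, hh, hh0, hx⟩ hx0
    have hne : h ≠ 0 := fun h0 ↦ hh0 (by rw [h0, map_zero])
    obtain ⟨n, y, hy, hy0, rfl⟩ := hD g hg (by
      rw [← hx]
      exact mul_ne_zero hx0 hne)
    obtain ⟨h', hh'⟩ := hinv h hh0
    obtain ⟨y', hy'⟩ := hinv y hy0
    refine ⟨n, y * h', ⟨y, hy, h, hh, hh0, ?_⟩, h * y', ⟨h, hh, y, hy, hy0, ?_⟩, ?_, ?_⟩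
    · linear_combination y * hh'
    · linear_combination h * hy'
    · linear_combination (y * y') * hh' + hy'
    · linear_combination h' * hx - x * hh'
  · rintro x ⟨g, hg, h, hh, hh0, hx⟩
    have : res x = res g / res h := by
      rw [← hx, map_mul, mul_div_cancel_right₀ _ hh0]
    rw [this]
    exact div_mem (hr g hg) (hr h hh)

theorem exists_isUnramifiedSubring [IsDomain V] [CharZero V] [Fact p.Prime] [CharP κ p]
    (hloc : ∀ x, res x ≠ 0 → IsUnit x) : ∃ C, IsUnramifiedSubring p res j C := by
  obtain ⟨C, -, hC⟩ := exists_isUnramifiedSubring_of_le (p := p) (j := j) hloc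
    (Int.castRingHom V).range (by
      rintro _ ⟨a, rfl⟩ ha
      have ha0 : a ≠ 0 := by
        rintro rfl
        simp at ha
      have hfin : FiniteMultiplicity (p : ℤ) a :=
        Int.finiteMultiplicity_iff.2 ⟨by simpa using (Fact.out : p.Prime).ne_one, ha0⟩
      obtain ⟨b, hab, hb⟩ := hfin.exists_eq_pow_mul_and_not_dvd
      refine ⟨multiplicity (p : ℤ) a, (b : V), ⟨b, by simp⟩, ?_, ?_⟩
      · rw [map_intCast, Ne, CharP.intCast_eq_zero_iff κ p]
        exact hb
      · have := congrArg (Int.castRingHom V) hab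
        simpa using this) (by
      rintro _ ⟨a, rfl⟩
      simp only [eq_intCast, map_intCast]
      exact intCast_mem _ _)
  exact ⟨C, hC⟩

namespace IsUnramifiedSubring

variable {C : Subring V}

theorem isUnit_or_dvd (hC : IsUnramifiedSubring p res j C) (x : C) : IsUnit x ∨ (p : C) ∣ x := by
  by_cases hx : x = 0
  · exact Or.inr (hx ▸ dvd_zero _)
  obtain ⟨n, u, hu, w, hw, huw, hxn⟩ := hC.factor x x.2 fun h ↦ hx (Subtype.ext h)
  have hx' : x = (p : C) ^ n * ⟨u, hu⟩ := Subtype.ext (by simpa using hxn)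
  rcases n with _ | n
  · left
    rw [hx', pow_zero, one_mul]
    exact IsUnit.of_mul_eq_one ⟨w, hw⟩ (Subtype.ext huw)
  · right
    exact ⟨(p : C) ^ n * ⟨u, hu⟩, by rw [hx']; ring⟩

theorem not_isUnit_natCast [CharP κ p] (C : Subring V) (res : V →+* κ) : ¬ IsUnit (p : C) := by
  intro h
  have := h.map (res.comp C.subtype)
  rw [map_natCast, CharP.cast_eq_zero] at this
  exact not_isUnit_zero this

theorem residue_eq_zero_iff [CharP κ p] (hC : IsUnramifiedSubring p res j C) (x : C) :
    res x = 0 ↔ (p : C) ∣ x := by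
  constructor
  · intro hx
    refine (hC.isUnit_or_dvd x).resolve_left fun hu ↦ ?_
    have := hu.map (res.comp C.subtype)
    exact this.ne_zero hx
  · rintro ⟨y, rfl⟩
    simp

theorem isDiscreteValuationRing [IsDomain V] [CharZero V] [CharP κ p] [Fact p.Prime]
    (hC : IsUnramifiedSubring p res j C) : IsDiscreteValuationRing C := by
  have hp0 : (p : C) ≠ 0 := fun h ↦ by
    have : (p : V) = 0 := by simpa using congrArg Subtype.val h
    exact (Fact.out : p.Prime).ne_zero (by exact_mod_cast this)
  refine IsDiscreteValuationRing.ofHasUnitMulPowIrreducibleFactorization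
    ⟨p, ⟨not_isUnit_natCast C res, fun a b hab ↦ ?_⟩, fun {x} hx ↦ ?_⟩
  · by_contra! hcon
    obtain ⟨a', rfl⟩ := (hC.isUnit_or_dvd a).resolve_left hcon.1
    obtain ⟨b', rfl⟩ := (hC.isUnit_or_dvd b).resolve_left hcon.2
    refine not_isUnit_natCast (p := p) C res (IsUnit.of_mul_eq_one (a' * b') ?_)
    apply mul_left_cancel₀ hp0
    linear_combination -hab
  · obtain ⟨n, u, hu, w, hw, huw, hxn⟩ := hC.factor x x.2 fun h ↦ hx (Subtype.ext h)
    exact ⟨n, ⟨⟨u, hu⟩, ⟨w, hw⟩, Subtype.ext huw, Subtype.ext ((mul_comm w u).trans huw)⟩,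
      Subtype.ext (by simpa using hxn.symm)⟩

/-- The primitive part of a polynomial over an unramified subring. -/
theorem exists_eq_C_pow_mul [IsDomain V] [CharP κ p] [CharZero V] [Fact p.Prime]
    (hC : IsUnramifiedSubring p res j C) {g : C[X]} (hg : g ≠ 0) :
    ∃ (n : ℕ) (g₁ : C[X]), g = Polynomial.C ((p : C) ^ n) * g₁ ∧
      g₁.map (res.comp C.subtype) ≠ 0 := by
  have hp0 : (p : V) ≠ 0 := by exact_mod_cast (Fact.out : p.Prime).ne_zero
  have hex : ∃ n : ℕ, ¬ Polynomial.C ((p : C) ^ n) ∣ g := by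
    obtain ⟨i, hi⟩ : ∃ i, g.coeff i ≠ 0 := by
      by_contra! h
      exact hg (Polynomial.ext h)
    obtain ⟨n, u, hu, w, hw, huw, hxn⟩ := hC.factor (g.coeff i) (g.coeff i).2
      fun h ↦ hi (Subtype.ext h)
    refine ⟨n + 1, fun h ↦ ?_⟩
    obtain ⟨v, hv⟩ := (Polynomial.C_dvd_iff_dvd_coeff _ _).1 h i
    have hv' : (p : V) ^ (n + 1) * v = (p : V) ^ n * u := by
      rw [← hxn, hv]
      simp
    have h1 : (p : V) * v = u := by
      apply mul_left_cancel₀ (pow_ne_zero n hp0)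
      rw [← hv']
      ring
    refine not_isUnit_natCast (p := p) C res (IsUnit.of_mul_eq_one (v * ⟨w, hw⟩) (Subtype.ext ?_))
    have : (p : V) * (v * w) = 1 := by rw [← huw, ← h1, mul_assoc]
    simpa using this
  classical
  have hspec := Nat.find_spec hex
  obtain ⟨n, hn⟩ : ∃ n, Nat.find hex = n + 1 :=
    Nat.exists_eq_succ_of_ne_zero fun h0 ↦ by
      rw [h0] at hspec
      simp at hspec
  have hmin := Nat.find_min hex (m := n) (by omega)
  rw [hn] at hspec
  rw [not_not] at hmin
  obtain ⟨g₁, hg₁⟩ := hmin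
  refine ⟨n, g₁, hg₁, fun h0 ↦ hspec ?_⟩
  have h1 : Polynomial.C (p : C) ∣ g₁ := by
    rw [Polynomial.C_dvd_iff_dvd_coeff]
    intro i
    rw [← hC.residue_eq_zero_iff]
    have := congrArg (fun f ↦ f.coeff i) h0
    simpa using this
  obtain ⟨g₂, rfl⟩ := h1
  exact ⟨g₂, by rw [hg₁, pow_succ, Polynomial.C_mul, mul_assoc]⟩

/-- A lift of an element of `k` over which an unramified subring can be extended. -/
theorem exists_lift [IsDomain V] (hres : Function.Surjective res) (hroot : IsRootClosed res)
    [CharP κ p]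
    (hC : IsUnramifiedSubring p res j C) (a : κ) :
    ∃ α, res α = a ∧ ∀ g : C[X], ∃ g₀ : C[X], g.eval₂ C.subtype α = g₀.eval₂ C.subtype α ∧
      ∀ g₁ : C[X], g₁.degree ≤ g₀.degree → g₁.map (res.comp C.subtype) ≠ 0 →
        g₁.eval₂ (res.comp C.subtype) a ≠ 0 := by
  let r := res.comp C.subtype
  let F : Subfield κ :=
    { r.range with
      inv_mem' := by
        rintro _ ⟨x, rfl⟩
        by_cases h0 : r x = 0
        · rw [h0, inv_zero]
          exact zero_mem r.range
        · have hu := (hC.isUnit_or_dvd x).resolve_right fun h ↦ h0 ((hC.residue_eq_zero_iff x).2 h)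
          obtain ⟨y, hy⟩ := hu.exists_right_inv
          exact ⟨y, eq_inv_of_mul_eq_one_right (by rw [← map_mul, hy, map_one])⟩ }
  let r' : C →+* F := r.codRestrict F fun x ↦ ⟨x, rfl⟩
  have hr' : Function.Surjective r' := by
    rintro ⟨_, x, rfl⟩
    exact ⟨x, rfl⟩
  have hrr : (algebraMap F κ).comp r' = r := rfl
  have hmap : ∀ g : C[X], g.map r ≠ 0 → g.map r' ≠ 0 := fun g hg h0 ↦ hg (by
    rw [← hrr, ← Polynomial.map_map, h0, Polynomial.map_zero])
  have heval : ∀ g : C[X], g.eval₂ r a = aeval a (g.map r') := fun g ↦ by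
    rw [aeval_def, eval₂_map, hrr]
  -- If a is algebraic over the residue field F of C, take α to be a root of a monic lift f of its
  -- minimal polynomial. Remainders modulo f have degree below that of the minimal polynomial, so
  -- nonzero reductions do not vanish at a. If a is transcendental, any lift works.
  by_cases hint : IsIntegral F a
  · obtain ⟨f, hf, hfd, hfm⟩ := lifts_and_degree_eq_and_monic (f := r') (p := minpoly F a)
      ((mem_lifts _).2 (map_surjective r' hr' _)) (minpoly.monic hint)
    obtain ⟨α, hα, hαa⟩ := hroot (f.map C.subtype) (hfm.map _) a (by
      rw [Polynomial.map_map, Polynomial.eval_map]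
      change f.eval₂ r a = 0
      rw [heval, hf, minpoly.aeval])
    refine ⟨α, hαa, fun g ↦ ⟨g %ₘ f, ?_, fun g₁ hg₁ h0 h ↦ ?_⟩⟩
    · conv_lhs => rw [← modByMonic_add_div g f]
      rw [Polynomial.eval_map] at hα
      rw [eval₂_add, eval₂_mul, hα, zero_mul, add_zero]
    · change g₁.eval₂ r a = 0 at h
      rw [heval] at h
      have h1 := minpoly.degree_le_of_ne_zero F a (hmap _ h0) h
      have h2 := degree_modByMonic_lt g hfm
      rw [hfd] at h2
      exact absurd (h1.trans (degree_map_le.trans hg₁)) (not_le.2 h2)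
  · obtain ⟨α, hα⟩ := hres a
    refine ⟨α, hα, fun g ↦ ⟨g, rfl, fun g₁ _ h0 h ↦ hint ?_⟩⟩
    change g₁.eval₂ r a = 0 at h
    rw [heval] at h
    exact isAlgebraic_iff_isIntegral.1 ⟨_, hmap _ h0, h⟩

end IsUnramifiedSubring

/-- For every field `k` of characteristic `p` there is a discrete valuation ring of
characteristic zero with uniformizer `p` and residue field `k`. -/
theorem exists_discreteValuationRing (k : Type u) [Field k] (p : ℕ) [Fact p.Prime] [CharP k p] :
    ∃ (C : Type u) (_ : CommRing C) (_ : IsDomain C) (_ : IsDiscreteValuationRing C)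
      (ρ : C →+* k), Function.Surjective ρ ∧ (∀ c, ρ c = 0 ↔ (p : C) ∣ c) ∧ (p : C) ≠ 0 := by
  obtain ⟨V, κ, _, _, _, _, res, j, hres, hloc, hroot⟩ := exists_isRootClosed k
  have : CharP κ p := charP_of_injective_ringHom j.injective p
  obtain ⟨C₀, hC₀⟩ := exists_isUnramifiedSubring (p := p) (j := j) hloc
  obtain ⟨C, -, hmax⟩ := zorn_le_nonempty₀ {C | IsUnramifiedSubring p res j C}
    (fun c hc hchain T₀ hT₀ ↦ by
      have hmem : ∀ x, x ∈ sSup c ↔ ∃ T ∈ c, x ∈ T := fun x ↦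
        Subring.mem_sSup_of_directedOn ⟨T₀, hT₀⟩ hchain.directedOn
      refine ⟨sSup c, ⟨fun x hx hx0 ↦ ?_, fun x hx ↦ ?_⟩, fun _ ↦ le_sSup⟩
      · obtain ⟨T, hT, hxT⟩ := (hmem x).1 hx
        obtain ⟨n, u, hu, w, hw, h⟩ := (hc hT).factor x hxT hx0
        exact ⟨n, u, (le_sSup hT : T ≤ sSup c) hu, w, (le_sSup hT : T ≤ sSup c) hw, h⟩
      · obtain ⟨T, hT, hxT⟩ := (hmem x).1 hx
        exact (hc hT).residue x hxT) _ hC₀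
  have hC : IsUnramifiedSubring p res j C := hmax.prop
  -- For α from `exists_lift`, a nonzero value at α is a power of p times the value of a primitive
  -- polynomial, whose residue is nonzero. So C[α] localizes to an unramified subring, and
  -- maximality gives α ∈ C.
  have hsurj : ∀ a, ∃ x ∈ C, res x = j a := by
    intro a
    obtain ⟨α, hα, hlift⟩ := hC.exists_lift hres hroot (j a)
    have hev : ∀ g : (C : Type u)[X],
        res (g.eval₂ C.subtype α) = g.eval₂ (res.comp C.subtype) (j a) := fun g ↦ by
      rw [hom_eval₂, hα]
    obtain ⟨C', hle, hC'⟩ := exists_isUnramifiedSubring_of_le (p := p) (j := j) hloc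
      (eval₂RingHom C.subtype α).range (by
        rintro _ ⟨g, rfl⟩ hg
        obtain ⟨g₀, hg₀, hdeg⟩ := hlift g
        rw [coe_eval₂RingHom] at hg ⊢
        rw [hg₀] at hg ⊢
        have hne : g₀ ≠ 0 := by
          rintro rfl
          simp at hg
        obtain ⟨n, g₁, rfl, hg₁⟩ := hC.exists_eq_C_pow_mul hne
        refine ⟨n, _, ⟨g₁, rfl⟩, ?_, ?_⟩
        · rw [coe_eval₂RingHom, hev]
          refine hdeg g₁ ?_ hg₁
          rw [degree_mul]
          have : Polynomial.C ((p : C) ^ n) ≠ 0 := left_ne_zero_of_mul hne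
          rw [degree_C (fun h0 ↦ this (by rw [h0, map_zero])), zero_add]
        · rw [coe_eval₂RingHom, eval₂_mul, eval₂_C]
          simp) (by
        rintro _ ⟨g, rfl⟩
        rw [coe_eval₂RingHom, hev, eval₂_eq_sum_range]
        exact sum_mem fun i _ ↦ mul_mem (hC.residue _ (g.coeff i).2)
          (pow_mem (show j a ∈ j.fieldRange from ⟨a, rfl⟩) i))
    have hCC' : C ≤ C' := fun x hx ↦ hle ⟨Polynomial.C ⟨x, hx⟩, by simp⟩
    exact ⟨α, hmax.le_of_ge hC' hCC' (hle ⟨X, by simp⟩), hα⟩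
  let e : k ≃+* j.range := RingEquiv.ofBijective j.rangeRestrict
    ⟨fun x y h ↦ j.injective (congrArg Subtype.val h), j.rangeRestrict_surjective⟩
  let ρ : C →+* k := e.symm.toRingHom.comp
    ((res.comp C.subtype).codRestrict j.range fun x ↦ hC.residue x x.2)
  have hρ : ∀ x, j (ρ x) = res x := fun x ↦ congrArg Subtype.val (e.apply_symm_apply _)
  refine ⟨C, inferInstance, inferInstance, hC.isDiscreteValuationRing, ρ, fun a ↦ ?_, fun c ↦ ?_,
    fun h ↦ ?_⟩
  · obtain ⟨x, hx, hxa⟩ := hsurj a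
    exact ⟨⟨x, hx⟩, j.injective (by rw [hρ, hxa])⟩
  · rw [← hC.residue_eq_zero_iff, ← hρ, map_eq_zero_iff j j.injective]
  · have : (p : V) = 0 := by simpa using congrArg Subtype.val h
    exact (Fact.out : p.Prime).ne_zero (by exact_mod_cast this)

end CohenRing

/-! ### Cohen's structure theorem for principal maximal ideals -/

section StructureTheorem

open Polynomial IsLocalRing

theorem isNilpotent_maximalIdeal (R : Type*) [CommRing R] [IsLocalRing R] [IsArtinianRing R] :
    IsNilpotent (maximalIdeal R) := by
  rw [← jacobson_eq_maximalIdeal (⊥ : Ideal R) bot_ne_top]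
  exact IsArtinianRing.isNilpotent_jacobson_bot

/-- A local ring with nilpotent principal maximal ideal which admits a lift of its residue field
to a Noetherian domain with principal kernel is a quotient of a discrete valuation ring. -/
theorem exists_discreteValuationRing_surjective_of_lift {R D : Type u} [CommRing R] [IsLocalRing R]
    [CommRing D] [IsDomain D] [IsNoetherianRing D] {t : R} (ht : maximalIdeal R = Ideal.span {t})
    (hnil : IsNilpotent t) (ψ : D →+* R) {ϖ : D} (hϖ : ϖ ≠ 0)
    (hsurj : ∀ a, ∃ c, residue R (ψ c) = a) (hker : ∀ c, residue R (ψ c) = 0 ↔ ϖ ∣ c) :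
    ∃ (S : Type u) (_ : CommRing S) (_ : IsDomain S) (_ : IsDiscreteValuationRing S)
      (σ : S →+* R), Function.Surjective σ := by
  have hmem : ∀ x, residue R x = 0 ↔ t ∣ x := fun x ↦ by
    rw [residue_eq_zero_iff, ht, Ideal.mem_span_singleton]
  let Φ : D[X] →+* R := eval₂RingHom ψ t
  have hΦX : Φ X = t := eval₂_X _ _
  have hΦC : ∀ c, Φ (C c) = ψ c := fun c ↦ eval₂_C _ _
  have hΦ : Function.Surjective Φ := by
    -- Expansion in powers of t with coefficients from D, which terminates because t is nilpotent.
    have key : ∀ n : ℕ, ∀ x, ∃ g y, x = Φ g + t ^ n * y := by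
      intro n
      induction n with
      | zero => exact fun x ↦ ⟨0, x, by simp⟩
      | succ n ih =>
        intro x
        obtain ⟨c, hc⟩ := hsurj (residue R x)
        obtain ⟨x', hx'⟩ := (hmem (x - ψ c)).1 (by rw [map_sub, hc, sub_self])
        obtain ⟨g, y, hgy⟩ := ih x'
        refine ⟨C c + X * g, y, ?_⟩
        rw [map_add, map_mul, hΦX, hΦC]
        linear_combination hx' + t * hgy
    obtain ⟨n, hn⟩ := hnil
    intro x
    obtain ⟨g, y, hgy⟩ := key n x
    exact ⟨g, by rw [hgy, hn, zero_mul, add_zero]⟩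
  obtain ⟨r, hr⟩ := (hmem (ψ ϖ)).1 ((hker ϖ).2 dvd_rfl)
  obtain ⟨g, rfl⟩ := hΦ r
  -- Imposing the relation ϖ = X g makes X alone generate the preimage of 𝔪.
  let e : D[X] := C ϖ - X * g
  have he : Φ e = 0 := by rw [map_sub, map_mul, hΦX, hΦC, hr, sub_self]
  let I : Ideal D[X] := Ideal.span {e}
  have hI : ∀ a ∈ I, Φ a = 0 := by
    intro a ha
    obtain ⟨b, rfl⟩ := Ideal.mem_span_singleton.1 ha
    rw [map_mul, he, zero_mul]
  let Ψ : D[X] ⧸ I →+* R := Ideal.Quotient.lift I Φ hI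
  have hΨ : ∀ f, Ψ (Ideal.Quotient.mk I f) = Φ f := fun f ↦ Ideal.Quotient.lift_mk I Φ hI
  let q : Ideal (D[X] ⧸ I) := (maximalIdeal R).comap Ψ
  have hq : q.IsPrime := Ideal.comap_isPrime Ψ _
  have hqX : q = Ideal.span {Ideal.Quotient.mk I X} := by
    refine le_antisymm (fun a ha ↦ ?_) ?_
    · obtain ⟨f, rfl⟩ := Ideal.Quotient.mk_surjective a
      obtain ⟨f', c, rfl⟩ : ∃ f' c, f = X * f' + C c := ⟨_, _, (X_mul_divX_add f).symm⟩
      rw [Ideal.mem_comap, hΨ, ← residue_eq_zero_iff, map_add, map_mul, hΦX,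
        hΦC, map_add, (hmem (t * _)).2 (dvd_mul_right _ _), zero_add, hker] at ha
      obtain ⟨d, rfl⟩ := ha
      rw [Ideal.mem_span_singleton]
      refine ⟨Ideal.Quotient.mk I (f' + g * C d), ?_⟩
      rw [← map_mul, Ideal.Quotient.eq, Ideal.mem_span_singleton]
      refine ⟨C d, ?_⟩
      rw [C_mul]
      ring
    · rw [Ideal.span_singleton_le_iff_mem, Ideal.mem_comap, hΨ, hΦX, ht]
      exact Ideal.mem_span_singleton_self t
  let S := Localization.AtPrime q
  have hS : (maximalIdeal S).IsPrincipal := by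
    rw [← Localization.AtPrime.map_eq_maximalIdeal, congrArg (Ideal.map _) hqX, Ideal.map_span,
      Set.image_singleton]
    exact ⟨_, rfl⟩
  have hXq : Ideal.Quotient.mk I X ∈ q := hqX ▸ Ideal.mem_span_singleton_self _
  -- Otherwise s X^N ∈ (e) for some s outside q. As X is prime and does not divide e, whose constant
  -- term is ϖ ≠ 0, this forces s ∈ (e), so s vanishes in the quotient.
  have hnot : ¬ IsArtinianRing S := by
    intro hart
    obtain ⟨N, hN⟩ : IsNilpotent (maximalIdeal S) :=
      isNilpotent_maximalIdeal S
    have h1 : algebraMap (D[X] ⧸ I) S (Ideal.Quotient.mk I X) ∈ maximalIdeal S := by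
      rw [← Localization.AtPrime.map_eq_maximalIdeal]
      exact Ideal.mem_map_of_mem _ hXq
    have h2 := Ideal.pow_mem_pow h1 N
    rw [hN, Ideal.zero_eq_bot, Ideal.mem_bot, ← map_pow, ← map_pow,
      IsLocalization.map_eq_zero_iff q.primeCompl] at h2
    obtain ⟨⟨s, hs⟩, hsX⟩ := h2
    obtain ⟨s, rfl⟩ := Ideal.Quotient.mk_surjective s
    rw [← map_mul, Ideal.Quotient.eq_zero_iff_mem, Ideal.mem_span_singleton] at hsX
    obtain ⟨h, hh⟩ := hsX
    have hXe : ¬ X ∣ e := by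
      rw [X_dvd_iff]
      simpa [e] using hϖ
    obtain ⟨h', rfl⟩ := prime_X.pow_dvd_of_dvd_mul_left N hXe (Dvd.intro_left s hh)
    have h3 : s = e * h' := by
      apply mul_right_cancel₀ (pow_ne_zero N (X_ne_zero (R := D)))
      linear_combination hh
    apply hs
    rw [Ideal.Quotient.eq_zero_iff_mem.2 (h3 ▸ Ideal.mul_mem_right _ _
      (Ideal.mem_span_singleton_self e) : s ∈ I)]
    exact q.zero_mem
  obtain ⟨hdom, hdvr⟩ := (isArtinianRing_or_isDiscreteValuationRing (R := S) hS).resolve_left hnot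
  let σ : S →+* R := IsLocalization.lift (M := q.primeCompl) (g := Ψ) fun y ↦
    not_not.1 fun hy ↦ y.2 ((mem_maximalIdeal _).2 hy)
  refine ⟨S, inferInstance, hdom, hdvr, σ, fun x ↦ ?_⟩
  obtain ⟨f, rfl⟩ := hΦ x
  exact ⟨algebraMap _ S (Ideal.Quotient.mk I f), by rw [IsLocalization.lift_eq, hΨ]⟩

/-- An Artinian local ring with principal maximal ideal is a hypersurface. -/
theorem isHypersurface_of_isPrincipal {R : Type u} [CommRing R] [IsLocalRing R]
    [IsArtinianRing R] (h : (maximalIdeal R).IsPrincipal) : IsHypersurface R := by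
  obtain ⟨t, ht⟩ := h
  rw [Ideal.submodule_span_eq] at ht
  have hI := isNilpotent_maximalIdeal R
  have hnil : IsNilpotent t := by
    obtain ⟨n, hn⟩ := hI
    refine ⟨n, ?_⟩
    have := Ideal.pow_mem_pow (ht ▸ Ideal.mem_span_singleton_self t : t ∈ maximalIdeal R) n
    rwa [hn] at this
  suffices ∃ (S : Type u) (_ : CommRing S) (_ : IsDomain S) (_ : IsDiscreteValuationRing S)
      (σ : S →+* R), Function.Surjective σ by
    obtain ⟨S, _, _, _, σ, hσ⟩ := this
    exact isHypersurface_of_surjective σ hσ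
  obtain ⟨p, hp⟩ := CharP.exists (ResidueField R)
  rcases Nat.eq_zero_or_pos p with rfl | hpos
  · have hcz : CharZero (ResidueField R) := CharP.charP_to_charZero _
    obtain ⟨_⟩ : Nonempty (Algebra ℚ R) := by
      rw [EqualCharZero.nonempty_algebraRat_iff]
      intro J hJ
      have : CharZero (R ⧸ maximalIdeal R) := hcz
      exact ⟨fun a b hab ↦ by
        simpa using congrArg (Ideal.Quotient.factor (le_maximalIdeal hJ)) hab⟩
    obtain ⟨ψ, hψ⟩ := exists_lift_of_charZero hI (RingHom.id (ResidueField R))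
    have hψ' : ∀ c, residue R (ψ c) = c := hψ
    -- Since k itself would give ϖ = 0, it is replaced by k[X] with X ↦ 0, so that ϖ = X is nonzero.
    refine exists_discreteValuationRing_surjective_of_lift (D := (ResidueField R)[X]) ht hnil
      (ψ.comp (evalRingHom 0)) X_ne_zero (fun a ↦ ⟨C a, ?_⟩) fun c ↦ ?_
    · simp [hψ']
    · rw [RingHom.comp_apply, hψ', X_dvd_iff, coeff_zero_eq_eval_zero, coe_evalRingHom]
  · have hprime : Fact p.Prime := ⟨(CharP.char_is_prime_or_zero (ResidueField R) p).resolve_right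
      hpos.ne'⟩
    obtain ⟨D, _, _, _, ρ, hρ, hker, hp0⟩ := exists_discreteValuationRing (ResidueField R) p
    obtain ⟨ψ, hψ⟩ := exists_lift_of_isNilpotent hprime.out
      (fun c hc ↦ (mul_eq_zero.1 hc).resolve_left hp0) ρ hρ hker hI (by
        rw [← residue_eq_zero_iff, map_natCast, CharP.cast_eq_zero]) ρ
    have hψ' : ∀ c, residue R (ψ c) = ρ c := hψ
    exact exists_discreteValuationRing_surjective_of_lift ht hnil ψ hp0
      (fun a ↦ (hρ a).imp fun c hc ↦ by rw [hψ', hc]) fun c ↦ by rw [hψ', hker]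

end StructureTheorem

/-! ### Projective modules -/

section Projective

theorem qpl_le_zero_of_projective {R : Type u} [CommRing R] (M : Type u) [AddCommGroup M]
    [Module R M] [Module.Projective R M] : qpl R M ≤ 0 := by
  let A : ℤ → Submodule R M := fun i ↦ if i = 0 then ⊤ else ⊥
  have hA : ∀ i, i ≠ 0 → A i = ⊥ := fun i hi ↦ if_neg hi
  have hd : ∀ i j, j + 1 = i → ∀ x ∈ A i, (0 : M →ₗ[R] M) x ∈ A j := fun _ _ _ _ _ ↦ zero_mem _
  have hdd : ∀ x, (0 : M →ₗ[R] M) ((0 : M →ₗ[R] M) x) = 0 := fun _ ↦ rfl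
  let P := gradedComplex A 0 hd hdd
  have hsub : ∀ i : ℤ, i ≠ 0 → Subsingleton (P.X i) := by
    intro i h0
    change Subsingleton (A i)
    rw [hA i h0]
    infer_instance
  have hb : ∀ i, Nontrivial (P.X i) → (0 : ℤ) ≤ i ∧ i ≤ 0 := by
    intro i hi
    by_contra h
    exact not_subsingleton _ (hsub i (by omega))
  have hproj : ∀ i, Module.Projective R (P.X i) := by
    intro i
    change Module.Projective R (A i)
    by_cases h0 : i = 0
    · subst h0
      exact .of_equiv (Submodule.topEquiv (R := R) (M := M)).symm
    · rw [hA i h0]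
      infer_instance
  have H0 : Nonempty ((P.homology 0 : ModuleCat.{u} R) ≃ₗ[R] M) :=
    gradedComplex_homology hd hdd 0 (Submodule.subtype _)
      (fun x ↦ ⟨⟨x, trivial, rfl⟩, rfl⟩) fun z ↦ by
        constructor
        · intro h
          exact ⟨0, zero_mem _, h.symm⟩
        · rintro ⟨y, -, hy⟩
          exact hy.symm
  have hP : IsFiniteQuasiProjectiveResolution M P := by
    refine .of_bounds hb hproj ⟨fun i ↦ if i = 0 then 1 else 0, ⟨0, by simp⟩, fun i ↦ ?_⟩
    by_cases h0 : i = 0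
    · subst h0
      obtain ⟨e⟩ := H0
      exact ⟨e.trans (LinearEquiv.funUnique (Fin 1) R M).symm⟩
    · have := hsub i h0
      have := subsingleton_homology P i
      beta_reduce
      rw [if_neg h0]
      exact ⟨0⟩
  simpa using qpl_le_of_bounds hb hP

end Projective

/-! ### Finitistic quasi-projective length and the two equivalences -/

section Finitistic

open IsLocalRing

theorem qpl_le_finqpl {R : Type u} [CommRing R] (M : Type u) [AddCommGroup M] [Module R M]
    [Module.Finite R M] (h : qpl R M < ⊤) : qpl R M ≤ finqpl R :=
  le_sSup ⟨ModuleCat.of R M, ‹_›, h, rfl⟩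

theorem finqpl_le {R : Type u} [CommRing R] {x : EReal}
    (h : ∀ (M : Type u) [AddCommGroup M] [Module R M] [Module.Finite R M],
      qpl R M < ⊤ → qpl R M ≤ x) : finqpl R ≤ x := by
  refine sSup_le ?_
  rintro _ ⟨M, _, hM, rfl⟩
  exact h M hM

theorem finqpl_le_zero_of_isField {R : Type u} [CommRing R] (hR : IsField R) : finqpl R ≤ 0 := by
  let _ := hR.toField
  exact finqpl_le fun M _ _ _ _ ↦ qpl_le_zero_of_projective M

theorem qpl_residueField_le_finqpl (R : Type u) [CommRing R] [IsNoetherianRing R]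
    [IsLocalRing R] : qpl R (ResidueField R) ≤ finqpl R :=
  qpl_le_finqpl _ (qpl_residueField_lt_top R)

theorem finqpl_eq_zero_of_isField {R : Type u} [CommRing R] [IsNoetherianRing R] [IsLocalRing R]
    (hR : IsField R) : finqpl R = 0 :=
  le_antisymm (finqpl_le_zero_of_isField hR) (qpl_nonneg.trans (qpl_residueField_le_finqpl R))

theorem tfae_finqpl_eq_zero (R : Type u) [CommRing R] [IsNoetherianRing R] [IsLocalRing R] :
    List.TFAE [finqpl R = 0, qpl R (ResidueField R) = 0, IsField R] := by
  tfae_have 1 → 2 := fun h ↦ le_antisymm (h ▸ qpl_residueField_le_finqpl R) qpl_nonneg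
  tfae_have 2 → 3 := isField_of_qpl_residueField_eq_zero
  tfae_have 3 → 1 := finqpl_eq_zero_of_isField
  tfae_finish

theorem tfae_finqpl_eq_one (R : Type u) [CommRing R] [IsNoetherianRing R] [IsLocalRing R] :
    List.TFAE
      [finqpl R = 1, qpl R (ResidueField R) = 1,
       (∃ _ : IsDomain R, IsDiscreteValuationRing R) ∨
       (¬ IsField R ∧ IsArtinianRing R ∧ IsHypersurface R) ∨
       (¬ IsField R ∧ maximalIdeal R ^ 2 = ⊥)] := by
  have hk := qpl_residueField_le_finqpl R
  have hone : ¬ IsField R → 1 ≤ qpl R (ResidueField R) := fun h ↦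
    one_le_qpl (mt isField_of_qpl_residueField_eq_zero h)
  tfae_have 1 → 2 := fun h ↦ le_antisymm (h ▸ hk) (hone fun hR ↦ by
    rw [finqpl_eq_zero_of_isField hR] at h
    exact zero_ne_one h)
  tfae_have 2 → 3 := by
    intro h
    have hR : ¬ IsField R := fun hR ↦ by
      rw [h, finqpl_eq_zero_of_isField hR] at hk
      exact not_le.2 zero_lt_one hk
    obtain h1 | h2 | h3 := of_qpl_residueField_le_one h.le
    · exact absurd h1 hR
    · exact Or.inr (Or.inr ⟨hR, h2⟩)
    · rcases isArtinianRing_or_isDiscreteValuationRing h3 with hA | hD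
      · exact Or.inr (Or.inl ⟨hR, hA, isHypersurface_of_isPrincipal h3⟩)
      · exact Or.inl hD
  tfae_have 3 → 1 := by
    intro h
    suffices h : ¬ IsField R ∧ ∀ (M : Type u) [AddCommGroup M] [Module R M] [Module.Finite R M],
        qpl R M < ⊤ → qpl R M ≤ 1 from
      le_antisymm (finqpl_le h.2) ((hone h.1).trans hk)
    rcases h with ⟨_, _⟩ | ⟨hR, _, hH⟩ | ⟨hR, h2⟩
    · exact ⟨IsDiscreteValuationRing.not_isField R,
        fun M _ _ _ _ ↦ qpl_le_one_of_isPrincipalIdealRing M⟩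
    · obtain ⟨S, _, _, _, σ, f, hσ, hf, hker⟩ := hH.exists_discreteValuationRing
      exact ⟨hR, fun M _ _ _ _ ↦ qpl_le_one_of_quotient σ hσ hf hker M⟩
    · exact ⟨hR, fun M _ _ _ h ↦ qpl_le_one_of_sq_eq_bot hR h2 h⟩
  tfae_finish

end Finitistic

end QuasiProjective

theorem theorem5p5 (R : Type u) [CommRing R] [IsNoetherianRing R] [IsLocalRing R] :
    List.TFAE
      [QuasiProjective.finqpl R = 0,
       QuasiProjective.qpl R (IsLocalRing.ResidueField R) = 0,
       IsField R] ∧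
    List.TFAE
      [QuasiProjective.finqpl R = 1,
       QuasiProjective.qpl R (IsLocalRing.ResidueField R) = 1,
       (∃ _ : IsDomain R, IsDiscreteValuationRing R) ∨
       (¬ IsField R ∧ IsArtinianRing R ∧ QuasiProjective.IsHypersurface R) ∨
       (¬ IsField R ∧ IsLocalRing.maximalIdeal R ^ 2 = ⊥)] :=
  ⟨QuasiProjective.tfae_finqpl_eq_zero R, QuasiProjective.tfae_finqpl_eq_one R⟩
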